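/- **Setting.** Let $k\ge 2$, $0\le l<k<n$, and let $\Omega\subset\mathbb R^n$ be bounded and open. Let $\sigma_m$ be the $m$-th elementary symmetric polynomial ($\sigma_0=1$), $\Gamma_k=\{\mu\in\mathbb R^n:\sigma_m(\mu)>0,\ 1\le m\le k\}$ and $\widetilde\Gamma_k=\{\kappa\in\mathbb R^n:(\sum_{j\ne i}\kappa_j)_{i}\in\Gamma_k\}$. For a function $u$ with $|Du|<1$ put $$g_{ij}=\delta_{ij}-u_iu_j,\qquad h_{ij}=\frac{u_{ij}}{\sqrt{1-|Du|^2}},\qquad H=g^{ij}h_{ij},\qquad \eta=Hg-h;$$ $\kappa[M_u]$ and $\lambda(\eta[M_u])$ denote the eigenvalues, with multiplicity, of $h$ and of $\eta$ with respect to $g$ (so $\kappa[M_u]$ are the principal curvatures of the graph $M_u$ of $u$ in Minkowski space $\mathbb R^{n,1}$). A function $u\in C^2(\Omega)\cap C^1(\overline\Omega)$ is *admissible* if $\sup_{\overline\Omega}|Du|<1$ and $\kappa[M_u]\in\widetilde\Gamma_k$ at every point of $\Omega$. Let $\psi=\psi(x,z)\in C^\infty(\overline\Omega\times\mathbb R)$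 with $\psi>0$ and $\psi_z\ge 0$, and consider the Dirichlet problem $$(*)\qquad \frac{\sigma_k}{\sigma_l}\big(\lambda(\eta[M_u])\big)=\psi(x,u)\ \text{ in }\Omega,\qquad u=0\ \text{ on }\partial\Omega .$$ Write $\tilde w=1/\sqrt{1-|Du|^2}$ on $\overline\Omega$. **Theorem.** 1. Let $K,M\in\mathbb R$ and $c>0$. There is a constant $C>0$, depending only on $n,k,l,K,c,M$, such that for all $\Omega,\psi$ as above and every admissible solution $u\in C^3(\Omega)\cap C^1(\overline\Omega)$ of $(*)$ with $|u|\le M$ on $\overline\Omega$, and with $|D_x\psi|\le K$ and $\psi\ge c$ on $\Omega\times[-M,M]$, $$\sup_{\overline\Omega}\tilde w\le C\Big(1+\sup_{\partial\Omega}\tilde w\Big).$$ 2. For every $\theta\in(0,1)$ there is $\theta_0\in(0,1)$, depending only on $n,k,l,K,c,M,\theta$, such that every $u$ as in part 1 (for any $\Omega,\psi$ as there) with $\sup_{\partial\Omega}|Du|\le 1-\theta$ satisfies $\sup_{\overline\Omega}|Du|\le 1-\theta_0$. 3. Suppose $\partial\Omega$ is smooth and $(*)$ has an admissible subsolution $\underline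 u\in C^2(\Omega)\cap C^1(\overline\Omega)$, that is, $\underline u$ is admissible, $\frac{\sigma_k}{\sigma_l}(\lambda(\eta[M_{\underline u}]))\ge\psi(x,\underline u)$ in $\Omega$ and $\underline u=0$ on $\partial\Omega$. Then there is $\theta_0\in(0,1)$, depending only on $n,k,l,\Omega,\psi,\underline u$, such that every admissible solution $u\in C^3(\Omega)\cap C^1(\overline\Omega)$ of $(*)$ satisfies $\sup_{\overline\Omega}|Du|\le 1-\theta_0$. -/

import Mathlib

open scoped ContDiff

namespace MinkowskiGraph

noncomputable section

/-! ### Symmetric functions and cones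

Unordered `n`-tuples of reals (lists of eigenvalues counted with multiplicity) are multisets, and
`σ_m` is `Multiset.esymm · m`. -/

/-- `Γ_k = {μ : σ_m(μ) > 0 for 1 ≤ m ≤ k}`. -/
def gammaCone (k : ℕ) : Set (Multiset ℝ) :=
  {μ | ∀ m : ℕ, 1 ≤ m → m ≤ k → 0 < μ.esymm m}

/-- The tuple `μ_i = ∑_{j ≠ i} κ_j = (∑_j κ_j) - κ_i`. -/
def complementarySums (κ : Multiset ℝ) : Multiset ℝ :=
  κ.map fun t => κ.sum - t

/-- The cone of all `κ` whose tuple `(∑_{j ≠ i} κ_j)_i` lies in `Γ_k`. -/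
def gammaTildeCone (k : ℕ) : Set (Multiset ℝ) :=
  {κ | complementarySums κ ∈ gammaCone k}

/-- The eigenvalues of the bilinear form `a` with respect to the metric `g`: the eigenvalues,
with multiplicity, of `g⁻¹ a`. -/
def eigenvaluesWrt {n : ℕ} (g a : Matrix (Fin n) (Fin n) ℝ) : Multiset ℝ :=
  (g⁻¹ * a).charpoly.roots

/-! ### Geometry of the graph of `u` in Minkowski space -/

/-- The Hessian `u_{ij}`. -/
def hessian {n : ℕ} (u : EuclideanSpace ℝ (Fin n) → ℝ) (x : EuclideanSpace ℝ (Fin n)) :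
    Matrix (Fin n) (Fin n) ℝ :=
  Matrix.of fun i j =>
    fderiv ℝ (fderiv ℝ u) x (EuclideanSpace.single i 1) (EuclideanSpace.single j 1)

/-- The induced metric `g_{ij} = δ_{ij} - u_i u_j`. -/
def metric {n : ℕ} (u : EuclideanSpace ℝ (Fin n) → ℝ) (x : EuclideanSpace ℝ (Fin n)) :
    Matrix (Fin n) (Fin n) ℝ :=
  Matrix.of fun i j => (if i = j then 1 else 0) - gradient u x i * gradient u x j

/-- The second fundamental form `h_{ij} = u_{ij} / √(1 - |Du|²)` with respect to the upward unit
normal. -/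
def secondFundamentalForm {n : ℕ} (u : EuclideanSpace ℝ (Fin n) → ℝ)
    (x : EuclideanSpace ℝ (Fin n)) : Matrix (Fin n) (Fin n) ℝ :=
  Matrix.of fun i j => hessian u x i j / √(1 - ‖gradient u x‖ ^ 2)

/-- The principal curvatures `κ[M_u]`: the eigenvalues of `h` with respect to `g`. -/
def principalCurvatures {n : ℕ} (u : EuclideanSpace ℝ (Fin n) → ℝ)
    (x : EuclideanSpace ℝ (Fin n)) : Multiset ℝ :=
  eigenvaluesWrt (metric u x) (secondFundamentalForm u x)

/-- The (unnormalized) mean curvature `H = g^{ij} h_{ij} = κ_1 + ⋯ + κ_n`. -/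
def meanCurvature {n : ℕ} (u : EuclideanSpace ℝ (Fin n) → ℝ)
    (x : EuclideanSpace ℝ (Fin n)) : ℝ :=
  ((metric u x)⁻¹ * secondFundamentalForm u x).trace

/-- The tensor `η = H g - h`. -/
def etaTensor {n : ℕ} (u : EuclideanSpace ℝ (Fin n) → ℝ)
    (x : EuclideanSpace ℝ (Fin n)) : Matrix (Fin n) (Fin n) ℝ :=
  meanCurvature u x • metric u x - secondFundamentalForm u x

/-- The curvature function `(σ_k / σ_l)(λ(η[M_u]))`. -/
def quotientCurvature {n : ℕ} (k l : ℕ) (u : EuclideanSpace ℝ (Fin n) → ℝ)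
    (x : EuclideanSpace ℝ (Fin n)) : ℝ :=
  (eigenvaluesWrt (metric u x) (etaTensor u x)).esymm k /
    (eigenvaluesWrt (metric u x) (etaTensor u x)).esymm l

/-! ### Regularity up to the boundary -/

/-- The gradient of `u` on `closure Ω`: on `∂Ω` it is the limit of `Du` from inside `Ω`. -/
def gradBar {n : ℕ} (Ω : Set (EuclideanSpace ℝ (Fin n))) (u : EuclideanSpace ℝ (Fin n) → ℝ) :
    EuclideanSpace ℝ (Fin n) → EuclideanSpace ℝ (Fin n) :=
  extendFrom Ω (gradient u)

/-- `u ∈ C¹(closure Ω)`: `u` is `C¹` in `Ω`, and `u` and `Du` extend continuously to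
`closure Ω` (the extension of `u` being `u` itself). -/
structure IsC1UpToBoundary {n : ℕ} (Ω : Set (EuclideanSpace ℝ (Fin n)))
    (u : EuclideanSpace ℝ (Fin n) → ℝ) : Prop where
  contDiffOn : ContDiffOn ℝ 1 u Ω
  continuousOn : ContinuousOn u (closure Ω)
  exists_limit : ∀ x ∈ closure Ω, ∃ p, Filter.Tendsto (gradient u) (nhdsWithin x Ω) (nhds p)

/-- The function `1 / √(1 - |Du|²)` on `closure Ω`. -/
def wTilde {n : ℕ} (Ω : Set (EuclideanSpace ℝ (Fin n))) (u : EuclideanSpace ℝ (Fin n) → ℝ)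
    (x : EuclideanSpace ℝ (Fin n)) : ℝ :=
  1 / √(1 - ‖gradBar Ω u x‖ ^ 2)

/-- `∂Ω` is smooth: near each of its points `Ω` is the sublevel set `{ρ < 0}` of a smooth function
`ρ` with non-vanishing differential at the point. -/
def HasSmoothBoundary {n : ℕ} (Ω : Set (EuclideanSpace ℝ (Fin n))) : Prop :=
  ∀ p ∈ frontier Ω, ∃ ρ : EuclideanSpace ℝ (Fin n) → ℝ, ContDiff ℝ ∞ ρ ∧ fderiv ℝ ρ p ≠ 0 ∧
    ∀ᶠ x in nhds p, (x ∈ Ω ↔ ρ x < 0)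

/-! ### The Dirichlet problem -/

/-- `sup_{closure Ω} |Du| < 1`. -/
def IsSpacelike {n : ℕ} (Ω : Set (EuclideanSpace ℝ (Fin n)))
    (u : EuclideanSpace ℝ (Fin n) → ℝ) : Prop :=
  ∃ s < 1, ∀ x ∈ closure Ω, ‖gradBar Ω u x‖ ≤ s

/-- An admissible function of class `C²(Ω) ∩ C¹(closure Ω)`: it is spacelike and its graph is
`(η, k)`-convex. -/
structure IsAdmissible {n : ℕ} (k : ℕ) (Ω : Set (EuclideanSpace ℝ (Fin n)))
    (u : EuclideanSpace ℝ (Fin n) → ℝ) : Prop where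
  contDiffOn : ContDiffOn ℝ 2 u Ω
  isC1 : IsC1UpToBoundary Ω u
  spacelike : IsSpacelike Ω u
  convex : ∀ x ∈ Ω, principalCurvatures u x ∈ gammaTildeCone k

/-- `ψ = ψ(x, z) ∈ C^∞(closure Ω × ℝ)`, `ψ > 0` and `∂ψ/∂z ≥ 0`. -/
structure IsMonotoneSource {n : ℕ} (Ω : Set (EuclideanSpace ℝ (Fin n)))
    (ψ : EuclideanSpace ℝ (Fin n) × ℝ → ℝ) : Prop where
  smooth : ContDiffOn ℝ ∞ ψ (closure Ω ×ˢ Set.univ)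
  pos : ∀ x ∈ closure Ω, ∀ z : ℝ, 0 < ψ (x, z)
  deriv_nonneg : ∀ x ∈ Ω, ∀ z : ℝ, 0 ≤ deriv (fun t : ℝ => ψ (x, t)) z

/-- An admissible solution of `(σ_k / σ_l)(λ(η[M_u])) = ψ(x, u)` in `Ω`, `u = 0` on `∂Ω`. -/
structure IsAdmissibleSolution {n : ℕ} (k l : ℕ) (Ω : Set (EuclideanSpace ℝ (Fin n)))
    (ψ : EuclideanSpace ℝ (Fin n) × ℝ → ℝ) (u : EuclideanSpace ℝ (Fin n) → ℝ) : Prop where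
  admissible : IsAdmissible k Ω u
  equation : ∀ x ∈ Ω, quotientCurvature k l u x = ψ (x, u x)
  boundary : ∀ x ∈ frontier Ω, u x = 0

/-- An admissible subsolution: `(σ_k / σ_l)(λ(η[M_v])) ≥ ψ(x, v)` in `Ω`, `v = 0` on `∂Ω`. -/
structure IsAdmissibleSubsolution {n : ℕ} (k l : ℕ) (Ω : Set (EuclideanSpace ℝ (Fin n)))
    (ψ : EuclideanSpace ℝ (Fin n) × ℝ → ℝ) (v : EuclideanSpace ℝ (Fin n) → ℝ) : Prop where
  admissible : IsAdmissible k Ω v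
  inequality : ∀ x ∈ Ω, ψ (x, v x) ≤ quotientCurvature k l v x
  boundary : ∀ x ∈ frontier Ω, v x = 0

/-- The known data of the estimate: `|u| ≤ M` on `closure Ω`, and on `Ω × [-M, M]` the source
satisfies `|D_x ψ| ≤ K` and `ψ ≥ c`. -/
structure HasBounds {n : ℕ} (K c M : ℝ) (Ω : Set (EuclideanSpace ℝ (Fin n)))
    (ψ : EuclideanSpace ℝ (Fin n) × ℝ → ℝ) (u : EuclideanSpace ℝ (Fin n) → ℝ) : Prop where
  abs_le : ∀ x ∈ closure Ω, |u x| ≤ M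
  grad_le : ∀ x ∈ Ω, ∀ z : ℝ, |z| ≤ M → ‖gradient (fun y => ψ (y, z)) x‖ ≤ K
  le_source : ∀ x ∈ Ω, ∀ z : ℝ, |z| ≤ M → c ≤ ψ (x, z)

end

end MinkowskiGraph

/-!
*Interior.*  Write `w = 1 / √(1 - |Du|²)` and fix `B` with `K < B c`.  At an interior maximum of
`log w + B u`, `Du` is an eigenvector of `D²u`.  Differentiating the equation along `Du`, the
ellipticity of `σ_k / σ_l` and its homogeneity of degree `k - l` bound the left side above by
`-(k - l) B ψ ≤ -B c`, while `ψ_z ≥ 0` bounds the right side below by `-K`; so the maximum is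
attained on `∂Ω`, where `u = 0`.

*Boundary.*  Being mean-convex, `u` is `≤ 0`, and comparison with the subsolution `v`, made strict
by a small exponential barrier, gives `v ≤ u`.  Since `v = u = 0` on `∂Ω`, the inward derivatives
there satisfy `∂v ≤ ∂u ≤ 0`, so `|Du| ≤ |Dv|` on `∂Ω`.
-/

namespace MinkowskiGraph

/-! ### Newton's inequalities -/

section Newton

open Polynomial

theorem laguerre_inequality {p : ℝ[X]} (hp : p.Splits) (x : ℝ) :
    p.eval x * (derivative (derivative p)).eval x ≤ (derivative p).eval x ^ 2 := by
  induction hp using Submonoid.closure_induction with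
  | mem p h => rcases h with ⟨a, rfl⟩ | ⟨a, rfl⟩ <;> simp
  | one => simp
  | mul p q _ _ hp hq =>
    simp only [derivative_mul, derivative_add, eval_add, eval_mul]
    nlinarith [mul_nonneg (sub_nonneg.2 hp) (sq_nonneg (q.eval x)),
      mul_nonneg (sub_nonneg.2 hq) (sq_nonneg (p.eval x))]

theorem splits_derivative {p : ℝ[X]} (hp : p.Splits) : (derivative p).Splits := by
  rw [splits_iff_card_roots] at hp ⊢
  have h_rolle := card_roots_le_derivative p
  have h_degree := natDegree_derivative_le p
  have h_card := card_roots' (derivative p)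
  omega

theorem splits_iterate_derivative {p : ℝ[X]} (hp : p.Splits) (j : ℕ) :
    (derivative^[j] p).Splits := by
  induction j with
  | zero => exact hp
  | succ j ih => rw [Function.iterate_succ_apply']; exact splits_derivative ih

theorem newton_inequality_coeff {p : ℝ[X]} (hp : p.Splits) (j : ℕ) :
    ((j : ℝ) + 2) * (p.coeff j * p.coeff (j + 2)) ≤ (j + 1) * p.coeff (j + 1) ^ 2 := by
  have h_taylor : ∀ i, (derivative^[i] p).eval 0 = (i.factorial : ℝ) * p.coeff i := fun i => by
    rw [← coeff_zero_eq_eval_zero, coeff_iterate_derivative]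
    simp [Nat.descFactorial_self]
  have h := laguerre_inequality (splits_iterate_derivative hp j) 0
  rw [← Function.iterate_succ_apply' derivative, ← Function.iterate_succ_apply' derivative,
    h_taylor, h_taylor, h_taylor] at h
  simp only [Nat.factorial_succ, Nat.succ_eq_add_one, Nat.cast_mul, Nat.cast_add,
    Nat.cast_one] at h
  refine le_of_mul_le_mul_left ?_ (by positivity : (0 : ℝ) < (j.factorial : ℝ) ^ 2 * (j + 1))
  linear_combination h

theorem newton_inequality (s : Multiset ℝ) {i j : ℕ} (hij : i + j + 2 = s.card) :
    ((i : ℝ) + 2) * (s.esymm j * s.esymm (j + 2)) ≤ (i + 1) * s.esymm (j + 1) ^ 2 := by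
  set p : ℝ[X] := (s.map fun r => X + C r).prod
  have hp : p.Splits := Splits.multisetProd fun f hf => by
    obtain ⟨a, -, rfl⟩ := Multiset.mem_map.1 hf
    exact Splits.X_add_C a
  have hcoeff : ∀ a b, a + b = s.card → p.coeff a = s.esymm b := fun a b hab => by
    rw [Multiset.prod_X_add_C_coeff s (by omega), ← hab, Nat.add_sub_cancel_left]
  have h := newton_inequality_coeff hp i
  rwa [hcoeff i (j + 2) (by omega), hcoeff (i + 1) (j + 1) (by omega),
    hcoeff (i + 2) j (by omega), mul_comm (s.esymm (j + 2))] at h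

theorem esymm_zero (s : Multiset ℝ) : s.esymm 0 = 1 := by
  simp [Multiset.esymm]

theorem esymm_cons (a : ℝ) (s : Multiset ℝ) (m : ℕ) :
    (a ::ₘ s).esymm (m + 1) = s.esymm (m + 1) + a * s.esymm m := by
  simp only [Multiset.esymm, Multiset.powersetCard_cons, Multiset.map_add, Multiset.sum_add,
    Multiset.map_map, Function.comp_def, Multiset.prod_cons, Multiset.sum_map_mul_left]

theorem esymm_eq_zero_of_card_lt {s : Multiset ℝ} {m : ℕ} (h : s.card < m) : s.esymm m = 0 := by
  simp [Multiset.esymm, Multiset.powersetCard_eq_empty _ h]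

theorem esymm_mul_esymm_lt_sq {s : Multiset ℝ} {j : ℕ} (h : s.esymm (j + 1) ≠ 0) :
    s.esymm j * s.esymm (j + 2) < s.esymm (j + 1) ^ 2 := by
  have h_sq : 0 < s.esymm (j + 1) ^ 2 := by positivity
  rcases lt_or_ge s.card (j + 2) with hj | hj
  · rwa [esymm_eq_zero_of_card_lt hj, mul_zero]
  · obtain ⟨i, hi⟩ := Nat.exists_eq_add_of_le' hj
    have := newton_inequality s (i := i) (j := j) (by omega)
    by_contra! hcon
    nlinarith

theorem esymm_mul_esymm_le_sq (s : Multiset ℝ) (j : ℕ) :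
    s.esymm j * s.esymm (j + 2) ≤ s.esymm (j + 1) ^ 2 := by
  by_cases h : s.esymm (j + 1) = 0
  · rcases lt_or_ge s.card (j + 2) with hj | hj
    · simp [esymm_eq_zero_of_card_lt hj, h]
    · obtain ⟨i, hi⟩ := Nat.exists_eq_add_of_le' hj
      have := newton_inequality s (i := i) (j := j) (by omega)
      rw [h, zero_pow two_ne_zero, mul_zero] at this
      rw [h, zero_pow two_ne_zero]
      exact nonpos_of_mul_nonpos_right this (by positivity)
  · exact (esymm_mul_esymm_lt_sq h).le

theorem esymm_pos_of_cons_mem_gammaCone {a : ℝ} {s : Multiset ℝ} {k : ℕ}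
    (h : a ::ₘ s ∈ gammaCone k) : ∀ m < k, 0 < s.esymm m := by
  intro m
  induction m with
  | zero => intro _; simp [esymm_zero]
  | succ m ih =>
    intro hm
    have h0 : 0 < s.esymm m := ih (by omega)
    have h1 := h (m + 1) (by omega) (by omega)
    have h2 := h (m + 2) (by omega) (by omega)
    rw [esymm_cons] at h1 h2
    by_contra! hcon
    nlinarith [esymm_mul_esymm_le_sq s m, mul_pos h2 h0, mul_nonneg (neg_nonneg.2 hcon) h1.le]

theorem esymm_mul_esymm_lt {s : Multiset ℝ} {k : ℕ} (h : ∀ m < k, 0 < s.esymm m) {l j : ℕ}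
    (hlj : l + 1 ≤ j) (hjk : j + 1 ≤ k) :
    s.esymm (j + 1) * s.esymm l < s.esymm j * s.esymm (l + 1) := by
  induction j, hlj using Nat.le_induction with
  | base =>
    have := esymm_mul_esymm_lt_sq (h (l + 1) (by omega)).ne'
    linarith
  | succ j hj ih =>
    have hl := h l (by omega)
    have hj0 := h j (by omega)
    have hj1 := h (j + 1) (by omega)
    refine lt_of_mul_lt_mul_left ?_ hj0.le
    calc s.esymm j * (s.esymm (j + 1 + 1) * s.esymm l)
        = (s.esymm j * s.esymm (j + 2)) * s.esymm l := by ring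
      _ < s.esymm (j + 1) ^ 2 * s.esymm l := by gcongr; exact esymm_mul_esymm_lt_sq hj1.ne'
      _ = s.esymm (j + 1) * (s.esymm (j + 1) * s.esymm l) := by ring
      _ < s.esymm (j + 1) * (s.esymm j * s.esymm (l + 1)) :=
          mul_lt_mul_of_pos_left (ih (by omega)) hj1
      _ = s.esymm j * (s.esymm (j + 1) * s.esymm (l + 1)) := by ring

end Newton

/-! ### Elementary symmetric functions of the eigenvalues of a matrix -/

section Determinant

open Matrix

variable {ι : Type*} [DecidableEq ι]

theorem det_diagonal_add_vecMulVec_of_ne_zero [Fintype ι] {F : Type*} [Field F] {a : ι → F}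
    (ha : ∀ i, a i ≠ 0) (u v : ι → F) :
    (diagonal a + vecMulVec u v).det =
      ∏ i, a i + ∑ i, u i * v i * ∏ j ∈ Finset.univ.erase i, a j := by
  have h_unit : IsUnit (diagonal a).det := by
    rw [det_diagonal]; exact (Finset.prod_ne_zero_iff.2 fun i _ => ha i).isUnit
  have h_inv : (diagonal a)⁻¹ = diagonal fun i => (a i)⁻¹ := by
    refine inv_eq_left_inv ?_
    rw [diagonal_mul_diagonal, ← diagonal_one]
    exact congrArg diagonal (funext fun i => inv_mul_cancel₀ (ha i))
  have h := det_add_replicateCol_mul_replicateRow (ι := Unit) h_unit u v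
  rw [← vecMulVec_eq, det_diagonal, h_inv] at h
  rw [h, det_unique, Matrix.add_apply, one_apply_eq, mul_add, mul_one, mul_apply, Finset.mul_sum]
  congr 1
  refine Finset.sum_congr rfl fun i _ => ?_
  rw [mul_diagonal, ← Finset.mul_prod_erase Finset.univ a (Finset.mem_univ i)]
  simp only [replicateRow_apply, replicateCol_apply]
  field_simp [ha i]

theorem det_diagonal_add_vecMulVec [Fintype ι] (a u v : ι → ℝ) :
    (diagonal a + vecMulVec u v).det =
      ∏ i, a i + ∑ i, u i * v i * ∏ j ∈ Finset.univ.erase i, a j := by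
  have h_dense : Dense (Set.univ.pi fun _ : ι => ({0}ᶜ : Set ℝ)) :=
    dense_pi _ fun _ _ => dense_compl_singleton 0
  have h_left : Continuous fun a : ι → ℝ => (diagonal a + vecMulVec u v).det := by fun_prop
  have h_right : Continuous fun a : ι → ℝ =>
      ∏ i, a i + ∑ i, u i * v i * ∏ j ∈ Finset.univ.erase i, a j := by fun_prop
  exact congrFun (h_left.ext_on h_dense h_right fun a ha =>
    det_diagonal_add_vecMulVec_of_ne_zero (fun i => ha i (Set.mem_univ i)) u v) a

theorem det_principal_diagonal_add_smul_vecMulVec (d b : ι → ℝ) (t : ℝ) (s : Finset ι) :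
    ((diagonal d + t • vecMulVec b b).submatrix (Subtype.val : s → ι) Subtype.val).det =
      ∏ i ∈ s, d i + t * ∑ i ∈ s, b i ^ 2 * ∏ j ∈ s.erase i, d j := by
  have h_sub : (diagonal d + t • vecMulVec b b).submatrix (Subtype.val : s → ι) Subtype.val =
      diagonal (fun i : s => d i) + vecMulVec (fun i : s => t * b i) (fun i : s => b i) := by
    ext i j
    simp [diagonal_apply, vecMulVec_apply, mul_assoc]
  have h_erase : ∀ i : s, ∏ j ∈ Finset.univ.erase i, d j = ∏ j ∈ s.erase i, d j := fun i =>
    Finset.prod_nbij Subtype.val (fun j hj => by simpa using hj)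
      Subtype.val_injective.injOn
      (fun j hj => ⟨⟨j, Finset.mem_of_mem_erase hj⟩, by
        simpa [Subtype.ext_iff] using Finset.ne_of_mem_erase hj, rfl⟩) fun _ _ => rfl
  rw [h_sub, det_diagonal_add_vecMulVec, Finset.prod_coe_sort s d, Finset.mul_sum,
    ← Finset.sum_coe_sort s]
  congr 1
  refine Finset.sum_congr rfl fun i _ => ?_
  rw [h_erase]
  ring

end Determinant

section Sigma

open Polynomial Matrix

variable {ι : Type*} [Fintype ι] [DecidableEq ι]

/-- The `m`-th elementary symmetric function of the eigenvalues of a matrix, encoded as the sum of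
the principal `m × m` minors, which makes sense for every matrix and every `m`. -/
noncomputable def sigma (m : ℕ) (N : Matrix ι ι ℝ) : ℝ :=
  ∑ s ∈ Finset.univ.powersetCard m,
    (N.submatrix (Subtype.val : s → ι) (Subtype.val : s → ι)).det

theorem sigma_eq_charpoly_coeff {m : ℕ} (hm : m ≤ Fintype.card ι) (N : Matrix ι ι ℝ) :
    sigma m N = (-1) ^ m * N.charpoly.coeff (Fintype.card ι - m) := by
  rw [charpoly_coeff_eq_sum_minors N m hm, ← mul_assoc, ← mul_pow]
  simp [sigma]

theorem sigma_eq_zero_of_card_lt {m : ℕ} (hm : Fintype.card ι < m) (N : Matrix ι ι ℝ) :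
    sigma m N = 0 := by
  rw [sigma, Finset.powersetCard_eq_empty.2 (by simpa using hm), Finset.sum_empty]

theorem sigma_zero (N : Matrix ι ι ℝ) : sigma 0 N = 1 := by
  simp [sigma]

theorem sigma_one (N : Matrix ι ι ℝ) : sigma 1 N = N.trace := by
  simp [sigma, Finset.powersetCard_one, trace]

theorem sigma_smul (m : ℕ) (t : ℝ) (N : Matrix ι ι ℝ) :
    sigma m (t • N) = t ^ m * sigma m N := by
  simp only [sigma, Finset.mul_sum, submatrix_smul, Pi.smul_apply, det_smul, Fintype.card_coe]
  exact Finset.sum_congr rfl fun s hs => by rw [(Finset.mem_powersetCard.1 hs).2]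

theorem charpoly_conj {P Q : Matrix ι ι ℝ} (h : Q * P = 1) (N : Matrix ι ι ℝ) :
    (P * N * Q).charpoly = N.charpoly := by
  rw [charpoly_mul_comm, ← mul_assoc, h, one_mul]

theorem sigma_conj {P Q : Matrix ι ι ℝ} (h : Q * P = 1) (m : ℕ) (N : Matrix ι ι ℝ) :
    sigma m (P * N * Q) = sigma m N := by
  rcases le_or_gt m (Fintype.card ι) with hm | hm
  · rw [sigma_eq_charpoly_coeff hm, charpoly_conj h, sigma_eq_charpoly_coeff hm]
  · rw [sigma_eq_zero_of_card_lt hm, sigma_eq_zero_of_card_lt hm]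

theorem sigma_eq_esymm_roots {N : Matrix ι ι ℝ} (hN : N.charpoly.Splits) (m : ℕ) :
    sigma m N = N.charpoly.roots.esymm m := by
  have h_card : N.charpoly.roots.card = Fintype.card ι := by
    rw [splits_iff_card_roots.1 hN, N.charpoly_natDegree_eq_dim]
  rcases le_or_gt m (Fintype.card ι) with hm | hm
  · rw [sigma_eq_charpoly_coeff hm, coeff_eq_esymm_roots_of_splits hN (by simp),
      N.charpoly_monic.leadingCoeff, N.charpoly_natDegree_eq_dim, Nat.sub_sub_self hm, one_mul,
      ← mul_assoc, ← mul_pow]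
    simp
  · rw [sigma_eq_zero_of_card_lt hm, esymm_eq_zero_of_card_lt (h_card.trans_lt hm)]

/-- The slope of the affine function `t ↦ σ_m(diag d + t b bᵀ)`, equal to
`∑ i, b i ^ 2 * σ_{m-1}(d with the i-th entry removed)`. -/
noncomputable def rankOneSlope (d b : ι → ℝ) : ℕ → ℝ
  | 0 => 0
  | m + 1 => ∑ i, b i ^ 2 * ((Finset.univ.erase i).val.map d).esymm m

theorem sum_powersetCard_succ_erase (f : ι → Finset ι → ℝ) (m : ℕ) :
    ∑ s ∈ Finset.univ.powersetCard (m + 1), ∑ i ∈ s, f i (s.erase i) =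
      ∑ i, ∑ r ∈ (Finset.univ.erase i).powersetCard m, f i r := by
  rw [Finset.sum_sigma', Finset.sum_sigma']
  refine Finset.sum_bij' (fun x _ => ⟨x.2, x.1.erase x.2⟩) (fun y _ => ⟨insert y.1 y.2, y.1⟩)
    ?_ ?_ ?_ ?_ ?_
  · rintro ⟨s, i⟩ h
    simp only [Finset.mem_sigma, Finset.mem_powersetCard, Finset.subset_univ, true_and] at h
    simp [Finset.card_erase_of_mem h.2, h.1, Finset.erase_subset_erase]
  · rintro ⟨i, r⟩ h
    simp only [Finset.mem_sigma, Finset.mem_univ, Finset.mem_powersetCard, true_and] at h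
    have hi : i ∉ r := fun hi => by simpa using h.1 hi
    simp [Finset.card_insert_of_notMem hi, h.2]
  · rintro ⟨s, i⟩ h
    simp only [Finset.mem_sigma] at h
    simp [Finset.insert_erase h.2]
  · rintro ⟨i, r⟩ h
    simp only [Finset.mem_sigma, Finset.mem_univ, Finset.mem_powersetCard, true_and] at h
    have hi : i ∉ r := fun hi => by simpa using h.1 hi
    simp [Finset.erase_insert hi]
  · intro x _
    rfl

theorem sigma_diagonal_add_smul_vecMulVec (d b : ι → ℝ) (t : ℝ) (m : ℕ) :
    sigma m (diagonal d + t • vecMulVec b b) =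
      (Finset.univ.val.map d).esymm m + t * rankOneSlope d b m := by
  rcases m with _ | m
  · simp [sigma_zero, esymm_zero, rankOneSlope]
  · simp only [sigma, det_principal_diagonal_add_smul_vecMulVec, Finset.sum_add_distrib,
      ← Finset.mul_sum, Finset.esymm_map_val, rankOneSlope]
    rw [sum_powersetCard_succ_erase fun i r => b i ^ 2 * ∏ j ∈ r, d j]
    simp only [Finset.mul_sum]

theorem map_eq_cons_map_erase (d : ι → ℝ) (i : ι) :
    Finset.univ.val.map d = d i ::ₘ (Finset.univ.erase i).val.map d := by
  rw [← Multiset.map_cons, Finset.erase_val, Multiset.cons_erase (by simp)]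

theorem esymm_erase_pos {k m : ℕ} {d : ι → ℝ} (hd : Finset.univ.val.map d ∈ gammaCone k)
    (hm : m < k) (i : ι) : 0 < ((Finset.univ.erase i).val.map d).esymm m := by
  rw [map_eq_cons_map_erase d i] at hd
  exact esymm_pos_of_cons_mem_gammaCone hd m hm

theorem rankOneSlope_nonneg {k m : ℕ} {d : ι → ℝ} (hd : Finset.univ.val.map d ∈ gammaCone k)
    (hm : m ≤ k) (b : ι → ℝ) : 0 ≤ rankOneSlope d b m := by
  rcases m with _ | m
  · exact le_rfl
  · exact Finset.sum_nonneg fun i _ => mul_nonneg (sq_nonneg _) (esymm_erase_pos hd hm i).le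

theorem esymm_mul_rankOneSlope_lt {k l : ℕ} (hlk : l < k) {d b : ι → ℝ}
    (hd : Finset.univ.val.map d ∈ gammaCone k) (hb : b ≠ 0) :
    (Finset.univ.val.map d).esymm k * rankOneSlope d b l <
      rankOneSlope d b k * (Finset.univ.val.map d).esymm l := by
  set r : ι → Multiset ℝ := fun i => (Finset.univ.erase i).val.map d with hr_def
  have hr : ∀ i, ∀ m < k, 0 < (r i).esymm m := fun i m hm => esymm_erase_pos hd hm i
  obtain ⟨i₀, hi₀⟩ : ∃ i, b i ≠ 0 := Function.ne_iff.1 hb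
  obtain ⟨k, rfl⟩ := Nat.exists_eq_add_of_le' (show 1 ≤ k by omega)
  suffices h : ∃ q : ι → ℝ, (∀ i, 0 < q i) ∧
      rankOneSlope d b (k + 1) * (Finset.univ.val.map d).esymm l -
        (Finset.univ.val.map d).esymm (k + 1) * rankOneSlope d b l = ∑ i, b i ^ 2 * q i by
    obtain ⟨q, hq, h_eq⟩ := h
    rw [← sub_pos, h_eq]
    exact Finset.sum_pos' (fun i _ => mul_nonneg (sq_nonneg _) (hq i).le)
      ⟨i₀, Finset.mem_univ i₀, mul_pos (by positivity) (hq i₀)⟩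
  rcases l with _ | l
  · exact ⟨fun i => (r i).esymm k, fun i => hr i k (by omega), by
      simp [rankOneSlope, esymm_zero, hr_def]⟩
  · refine ⟨fun i => (r i).esymm k * (r i).esymm (l + 1) - (r i).esymm (k + 1) * (r i).esymm l,
      fun i => sub_pos.2 (esymm_mul_esymm_lt (hr i) (by omega) le_rfl), ?_⟩
    simp only [rankOneSlope]
    rw [Finset.sum_mul, Finset.mul_sum, ← Finset.sum_sub_distrib]
    refine Finset.sum_congr rfl fun i _ => ?_
    rw [map_eq_cons_map_erase d i, esymm_cons, esymm_cons]
    ring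

/-- The cone of matrices whose eigenvalues lie in `Γ_k`. -/
def IsGamma (k : ℕ) (N : Matrix ι ι ℝ) : Prop :=
  ∀ m : ℕ, 1 ≤ m → m ≤ k → 0 < sigma m N

theorem IsGamma.sigma_pos {k m : ℕ} {N : Matrix ι ι ℝ} (h : IsGamma k N) (hm : m ≤ k) :
    0 < sigma m N := by
  rcases Nat.eq_zero_or_pos m with rfl | h0
  · rw [sigma_zero]; exact one_pos
  · exact h m h0 hm

theorem exists_orthogonal_diagonalization {N : Matrix ι ι ℝ} (hN : N.IsSymm) :
    ∃ (U : Matrix ι ι ℝ) (d : ι → ℝ), Uᵀ * U = 1 ∧ N = U * diagonal d * Uᵀ := by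
  have hH : N.IsHermitian := isHermitian_iff_isSymm.2 hN
  refine ⟨hH.eigenvectorUnitary, hH.eigenvalues, ?_, ?_⟩
  · simpa [star_eq_conjTranspose] using Unitary.coe_star_mul_self hH.eigenvectorUnitary
  · have h := hH.spectral_theorem
    rw [Unitary.conjStarAlgAut_apply] at h
    simpa [star_eq_conjTranspose] using h

theorem IsGamma.exists_sigma_add_smul_vecMulVec {k l : ℕ} (hlk : l < k) {N : Matrix ι ι ℝ}
    (hN : N.IsSymm) (hG : IsGamma k N) {b : ι → ℝ} (hb : b ≠ 0) :
    ∃ τ : ℕ → ℝ, (∀ m t, sigma m (N + t • vecMulVec b b) = sigma m N + t * τ m) ∧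
      (∀ m ≤ k, 0 ≤ τ m) ∧ sigma k N * τ l < τ k * sigma l N := by
  obtain ⟨U, d, hU, rfl⟩ := exists_orthogonal_diagonalization hN
  have hU' : U * Uᵀ = 1 := mul_eq_one_comm.1 hU
  have h_diag : ∀ m t, sigma m (U * diagonal d * Uᵀ + t • vecMulVec b b) =
      (Finset.univ.val.map d).esymm m + t * rankOneSlope d (Uᵀ *ᵥ b) m := fun m t => by
    have hb : U *ᵥ (Uᵀ *ᵥ b) = b := by simp [hU']
    have h_conj : U * vecMulVec (Uᵀ *ᵥ b) (Uᵀ *ᵥ b) * Uᵀ = vecMulVec b b := by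
      rw [mul_vecMulVec, vecMulVec_mul, vecMul_transpose, hb]
    rw [← h_conj, ← Matrix.smul_mul, ← Matrix.mul_smul, ← add_mul, ← mul_add, sigma_conj hU,
      sigma_diagonal_add_smul_vecMulVec]
  have h_zero : ∀ m, sigma m (U * diagonal d * Uᵀ) = (Finset.univ.val.map d).esymm m := fun m => by
    simpa using h_diag m 0
  have hd : Finset.univ.val.map d ∈ gammaCone k := fun m h1 hm => h_zero m ▸ hG m h1 hm
  have h_ne : Uᵀ *ᵥ b ≠ 0 := fun h => hb <| by
    rw [← one_mulVec b, ← hU', ← mulVec_mulVec, h, mulVec_zero]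
  refine ⟨rankOneSlope d (Uᵀ *ᵥ b), fun m t => by rw [h_diag, h_zero],
    fun m hm => rankOneSlope_nonneg hd hm _, ?_⟩
  rw [h_zero, h_zero]
  exact esymm_mul_rankOneSlope_lt hlk hd h_ne

end Sigma

/-! ### The operator `σ_k / σ_l` on symmetric matrices -/

section MatrixCalculus

open Matrix
open scoped Matrix.Norms.Operator

variable {ι : Type*} [Fintype ι]

theorem contDiffAt_matrix {V : Type*} [NormedAddCommGroup V] [NormedSpace ℝ V] {r : WithTop ℕ∞}
    {M : V → Matrix ι ι ℝ} {x : V} (h : ∀ i j, ContDiffAt ℝ r (fun y => M y i j) x) :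
    ContDiffAt ℝ r M x :=
  (LinearMap.toContinuousLinearMap
    (Matrix.ofLinearEquiv ℝ : (ι → ι → ℝ) ≃ₗ[ℝ] _).toLinearMap).contDiff.contDiffAt.comp x
      (contDiffAt_pi.2 fun i => contDiffAt_pi.2 fun j => h i j)

theorem hasDerivAt_matrix {M : ℝ → Matrix ι ι ℝ} {M' : Matrix ι ι ℝ} {t : ℝ}
    (h : ∀ i j, HasDerivAt (fun s => M s i j) (M' i j) t) : HasDerivAt M M' t :=
  (LinearMap.toContinuousLinearMap
    (Matrix.ofLinearEquiv ℝ : (ι → ι → ℝ) ≃ₗ[ℝ] _).toLinearMap).hasFDerivAt.comp_hasDerivAt t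
      (hasDerivAt_pi.2 fun i => hasDerivAt_pi.2 fun j => h i j)

theorem contDiff_entry {r : WithTop ℕ∞} (i j : ι) :
    ContDiff ℝ r fun N : Matrix ι ι ℝ => N i j :=
  (LinearMap.toContinuousLinearMap (Matrix.entryLinearMap ℝ ℝ i j)).contDiff

end MatrixCalculus

section SigmaQuotient

open Matrix
open scoped Matrix.Norms.Operator

variable {ι : Type*} [Fintype ι] [DecidableEq ι]

theorem contDiff_sigma {r : WithTop ℕ∞} (m : ℕ) :
    ContDiff ℝ r (sigma m : Matrix ι ι ℝ → ℝ) := by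
  refine ContDiff.sum fun s _ => ?_
  simp only [det_apply', submatrix_apply]
  exact ContDiff.sum fun σ _ => contDiff_const.mul (contDiff_prod fun i _ => contDiff_entry _ _)

/-- The quotient `σ_k / σ_l` of the eigenvalues of a matrix; meaningful where `σ_l ≠ 0`, in
particular on the cone `IsGamma k` when `l ≤ k`. -/
noncomputable def sigmaQuotient (k l : ℕ) (N : Matrix ι ι ℝ) : ℝ :=
  sigma k N / sigma l N

variable {k l : ℕ} {N S : Matrix ι ι ℝ}

theorem sigmaQuotient_smul (hlk : l < k) {t : ℝ} (ht : t ≠ 0) (N : Matrix ι ι ℝ) :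
    sigmaQuotient k l (t • N) = t ^ (k - l) * sigmaQuotient k l N := by
  rw [sigmaQuotient, sigmaQuotient, sigma_smul, sigma_smul, pow_sub₀ t ht hlk.le, mul_div_mul_comm,
    div_eq_mul_inv (t ^ k)]

theorem IsGamma.add_vecMulVec (hlk : l < k) (hN : N.IsSymm) (hG : IsGamma k N) (b : ι → ℝ) :
    IsGamma k (N + vecMulVec b b) ∧
      sigmaQuotient k l N ≤ sigmaQuotient k l (N + vecMulVec b b) := by
  rcases eq_or_ne b 0 with rfl | hb
  · simpa using hG
  obtain ⟨τ, h_affine, hτ, h_lt⟩ := hG.exists_sigma_add_smul_vecMulVec hlk hN hb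
  have h_one : ∀ m, sigma m (N + vecMulVec b b) = sigma m N + τ m := fun m => by
    simpa using h_affine m 1
  refine ⟨fun m hm hmk => h_one m ▸ add_pos_of_pos_of_nonneg (hG m hm hmk) (hτ m hmk), ?_⟩
  have hl := hG.sigma_pos hlk.le
  rw [sigmaQuotient, sigmaQuotient, h_one, h_one,
    div_le_div_iff₀ hl (add_pos_of_pos_of_nonneg hl (hτ l hlk.le))]
  linarith

theorem IsGamma.add_posSemidef (hlk : l < k) (hN : N.IsSymm) (hG : IsGamma k N)
    (hS : S.PosSemidef) :
    IsGamma k (N + S) ∧ sigmaQuotient k l N ≤ sigmaQuotient k l (N + S) := by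
  obtain ⟨m, v, rfl⟩ := posSemidef_iff_eq_sum_vecMulVec.1 hS
  simp only [star_trivial]
  suffices h : ∀ s : Finset (Fin m), (N + ∑ i ∈ s, vecMulVec (v i) (v i)).IsSymm ∧
      IsGamma k (N + ∑ i ∈ s, vecMulVec (v i) (v i)) ∧
      sigmaQuotient k l N ≤ sigmaQuotient k l (N + ∑ i ∈ s, vecMulVec (v i) (v i)) from
    (h Finset.univ).2
  intro s
  induction s using Finset.induction_on with
  | empty => simpa using ⟨hN, hG⟩
  | insert i s hi ih =>
    obtain ⟨ih_symm, ih_gamma, ih_le⟩ := ih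
    obtain ⟨h_gamma, h_le⟩ := ih_gamma.add_vecMulVec hlk ih_symm (v i)
    rw [Finset.sum_insert hi, add_comm (vecMulVec (v i) (v i)), ← add_assoc]
    exact ⟨ih_symm.add (transpose_vecMulVec _ _), h_gamma, ih_le.trans h_le⟩

theorem IsGamma.contDiffAt_sigmaQuotient {r : WithTop ℕ∞} (hlk : l < k) (hG : IsGamma k N) :
    ContDiffAt ℝ r (sigmaQuotient k l) N :=
  (contDiff_sigma k).contDiffAt.div (contDiff_sigma l).contDiffAt (hG.sigma_pos hlk.le).ne'

theorem IsGamma.hasFDerivAt_sigmaQuotient (hlk : l < k) (hG : IsGamma k N) :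
    HasFDerivAt (sigmaQuotient k l) (fderiv ℝ (sigmaQuotient k l) N) N :=
  ((hG.contDiffAt_sigmaQuotient hlk).differentiableAt one_ne_zero).hasFDerivAt

theorem IsGamma.fderiv_vecMulVec_pos (hlk : l < k) (hN : N.IsSymm) (hG : IsGamma k N) {b : ι → ℝ}
    (hb : b ≠ 0) : 0 < fderiv ℝ (sigmaQuotient k l) N (vecMulVec b b) := by
  obtain ⟨τ, h_affine, -, h_lt⟩ := hG.exists_sigma_add_smul_vecMulVec hlk hN hb
  have hl := hG.sigma_pos hlk.le
  have h_lin : ∀ m, HasDerivAt (fun t : ℝ => sigma m N + t * τ m) (τ m) 0 := fun m => by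
    simpa using ((hasDerivAt_id (0 : ℝ)).mul_const (τ m)).const_add (sigma m N)
  have h_quot := (h_lin k).fun_div (h_lin l) (by simpa using hl.ne')
  have h_line := (hG.hasFDerivAt_sigmaQuotient hlk).hasLineDerivAt (vecMulVec b b)
  have h_value : fderiv ℝ (sigmaQuotient k l) N (vecMulVec b b) = _ :=
    h_line.unique (h_quot.congr_of_eventuallyEq
      (.of_forall fun t => by simp only [sigmaQuotient, h_affine]))
  rw [h_value]
  simp only [zero_mul, add_zero]
  exact div_pos (by linarith) (by positivity)

theorem IsGamma.fderiv_pos (hlk : l < k) (hN : N.IsSymm) (hG : IsGamma k N) (hS : S.PosSemidef)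
    (hS0 : S ≠ 0) : 0 < fderiv ℝ (sigmaQuotient k l) N S := by
  obtain ⟨m, v, rfl⟩ := posSemidef_iff_eq_sum_vecMulVec.1 hS
  simp only [star_trivial, map_sum] at hS0 ⊢
  obtain ⟨i, -, hi⟩ := Finset.exists_ne_zero_of_sum_ne_zero hS0
  refine Finset.sum_pos' (fun j _ => ?_) ⟨i, Finset.mem_univ i,
    hG.fderiv_vecMulVec_pos hlk hN fun h => hi (by simp [h])⟩
  rcases eq_or_ne (v j) 0 with hj | hj
  · simp [hj]
  · exact (hG.fderiv_vecMulVec_pos hlk hN hj).le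

theorem IsGamma.fderiv_self (hlk : l < k) (hG : IsGamma k N) :
    fderiv ℝ (sigmaQuotient k l) N N = ((k - l : ℕ) : ℝ) * sigmaQuotient k l N := by
  have h_pow : HasDerivAt (fun t : ℝ => (1 + t) ^ (k - l) * sigmaQuotient k l N)
      (((k - l : ℕ) : ℝ) * sigmaQuotient k l N) 0 := by
    simpa using
      (((hasDerivAt_id (0 : ℝ)).const_add 1).pow (k - l)).mul_const (sigmaQuotient k l N)
  refine ((hG.hasFDerivAt_sigmaQuotient hlk).hasLineDerivAt N).unique
    (h_pow.congr_of_eventuallyEq ?_)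
  have h_ne : ∀ᶠ t : ℝ in nhds 0, 1 + t ≠ 0 :=
    ContinuousAt.eventually_ne (by fun_prop) (by simp)
  filter_upwards [h_ne] with t ht
  rw [← sigmaQuotient_smul hlk ht, add_smul, one_smul]

end SigmaQuotient

section ComplementaryMatrix

open Matrix

variable {ι : Type*} [Fintype ι] [DecidableEq ι]

/-- The matrix `(tr W) I - W`, whose eigenvalues are `∑_{j ≠ i} κ_j` when those of `W` are `κ`. -/
noncomputable def complementaryMatrix : Matrix ι ι ℝ →ₗ[ℝ] Matrix ι ι ℝ :=
  (traceLinearMap ι ℝ ℝ).smulRight 1 - LinearMap.id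

theorem complementaryMatrix_apply (W : Matrix ι ι ℝ) :
    complementaryMatrix W = W.trace • (1 : Matrix ι ι ℝ) - W := rfl

theorem trace_complementaryMatrix (W : Matrix ι ι ℝ) :
    (complementaryMatrix W).trace = ((Fintype.card ι : ℝ) - 1) * W.trace := by
  rw [complementaryMatrix_apply, trace_sub, trace_smul, trace_one, smul_eq_mul]
  ring

theorem isSymm_complementaryMatrix {W : Matrix ι ι ℝ} (hW : W.IsSymm) :
    (complementaryMatrix W).IsSymm :=
  (isSymm_one.smul _).sub hW

theorem posSemidef_complementaryMatrix_vecMulVec (v : ι → ℝ) :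
    (complementaryMatrix (vecMulVec v v)).PosSemidef := by
  refine PosSemidef.of_dotProduct_mulVec_nonneg
    (isHermitian_iff_isSymm.2 (isSymm_complementaryMatrix (transpose_vecMulVec v v))) fun x => ?_
  have h_cauchy_schwarz : (v ⬝ᵥ x) ^ 2 ≤ (v ⬝ᵥ v) * (x ⬝ᵥ x) := by
    simpa only [dotProduct, sq] using Finset.sum_mul_sq_le_sq_mul_sq Finset.univ v x
  rw [star_trivial, complementaryMatrix_apply, trace_vecMulVec, sub_mulVec, dotProduct_sub,
    smul_mulVec, one_mulVec, vecMulVec_mulVec, dotProduct_smul, op_smul_eq_smul, dotProduct_smul,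
    dotProduct_comm x v, smul_eq_mul, smul_eq_mul]
  linarith

theorem posSemidef_complementaryMatrix {S : Matrix ι ι ℝ} (hS : S.PosSemidef) :
    (complementaryMatrix S).PosSemidef := by
  obtain ⟨m, v, rfl⟩ := posSemidef_iff_eq_sum_vecMulVec.1 hS
  simp only [map_sum, star_trivial]
  exact posSemidef_sum _ fun i _ => posSemidef_complementaryMatrix_vecMulVec (v i)

theorem complementaryMatrix_injective [Nontrivial ι] :
    Function.Injective (complementaryMatrix : Matrix ι ι ℝ → Matrix ι ι ℝ) := by
  refine (injective_iff_map_eq_zero complementaryMatrix).2 fun S h => ?_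
  have h_card : (Fintype.card ι : ℝ) - 1 ≠ 0 :=
    sub_ne_zero.2 (by exact_mod_cast Fintype.one_lt_card.ne')
  have h_trace : S.trace = 0 := by
    have := trace_complementaryMatrix S
    rw [h, trace_zero] at this
    exact (mul_eq_zero.1 this.symm).resolve_left h_card
  simpa [complementaryMatrix_apply, h_trace] using h

theorem IsGamma.nontrivial {k : ℕ} (hk : 1 ≤ k) {W : Matrix ι ι ℝ}
    (h : IsGamma k (complementaryMatrix W)) : Nontrivial ι := by
  have h_trace := h 1 le_rfl hk
  rw [sigma_one, trace_complementaryMatrix] at h_trace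
  by_contra! h_sub
  rcases isEmpty_or_nonempty ι with _ | _
  · simp [trace] at h_trace
  · simp [Fintype.card_eq_one_iff_nonempty_unique.2 ⟨⟨⟨Classical.arbitrary ι⟩,
      fun _ => Subsingleton.elim _ _⟩⟩] at h_trace

end ComplementaryMatrix

/-! ### The curvature operator as a function of the gradient and the Hessian -/

section ShapeMatrix

open Matrix

variable {ι : Type*} [Fintype ι] {p : ι → ℝ}

/-- The Lorentz factor `1 / √(1 - |p|²)`; meaningful for `|p| < 1`. -/
noncomputable def lorentzFactor (p : ι → ℝ) : ℝ := 1 / √(1 - p ⬝ᵥ p)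

theorem lorentzFactor_pos (hp : p ⬝ᵥ p < 1) : 0 < lorentzFactor p :=
  one_div_pos.2 (Real.sqrt_pos.2 (sub_pos.2 hp))

theorem lorentzFactor_sq_mul (hp : p ⬝ᵥ p < 1) : lorentzFactor p ^ 2 * (1 - p ⬝ᵥ p) = 1 := by
  rw [lorentzFactor, div_pow, one_pow, Real.sq_sqrt (sub_nonneg.2 hp.le)]
  exact one_div_mul_cancel (sub_pos.2 hp).ne'

theorem contDiffAt_lorentzFactor {r : WithTop ℕ∞} (hp : p ⬝ᵥ p < 1) :
    ContDiffAt ℝ r lorentzFactor p := by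
  have h_dot : ContDiff ℝ r fun q : ι → ℝ => q ⬝ᵥ q := by
    simp only [dotProduct]
    fun_prop
  exact contDiffAt_const.div ((contDiffAt_const.sub h_dot.contDiffAt).sqrt (sub_pos.2 hp).ne')
    (Real.sqrt_pos.2 (sub_pos.2 hp)).ne'

theorem hasDerivAt_lorentzFactor_ray (hp : p ⬝ᵥ p < 1) :
    HasDerivAt (fun t : ℝ => lorentzFactor ((1 + t) • p)) (lorentzFactor p ^ 3 * (p ⬝ᵥ p)) 0 := by
  have h_sub : HasDerivAt (fun t : ℝ => 1 - (1 + t) ^ 2 * (p ⬝ᵥ p)) (-(2 * (p ⬝ᵥ p))) 0 := by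
    simpa using ((((hasDerivAt_id (0 : ℝ)).const_add 1).pow 2).mul_const (p ⬝ᵥ p)).const_sub 1
  have h_sqrt : 0 < √(1 - p ⬝ᵥ p) := Real.sqrt_pos.2 (sub_pos.2 hp)
  have h_inv := (h_sub.sqrt (by simpa using (sub_pos.2 hp).ne')).fun_inv (by simpa using h_sqrt.ne')
  refine (h_inv.congr_of_eventuallyEq (.of_forall fun t => ?_)).congr_deriv ?_
  · simp only [lorentzFactor, one_div, smul_dotProduct, dotProduct_smul, smul_eq_mul]
    congr 3
    ring
  · simp only [lorentzFactor, add_zero, one_pow, one_mul]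
    field_simp

theorem vecMulVec_self_mul_self (p : ι → ℝ) :
    vecMulVec p p * vecMulVec p p = (p ⬝ᵥ p) • vecMulVec p p := by
  rw [vecMulVec_mul_vecMulVec, vecMulVec_smul]

/-- The symmetric square root of the inverse of the induced metric `δ_{ij} - p_i p_j`. -/
noncomputable def sqrtInvMetric [DecidableEq ι] (p : ι → ℝ) : Matrix ι ι ℝ :=
  1 + (lorentzFactor p ^ 2 / (lorentzFactor p + 1)) • vecMulVec p p

theorem sqrtInvMetric_coeff (hp : p ⬝ᵥ p < 1) :
    2 * (lorentzFactor p ^ 2 / (lorentzFactor p + 1)) +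
      (lorentzFactor p ^ 2 / (lorentzFactor p + 1)) ^ 2 * (p ⬝ᵥ p) = lorentzFactor p ^ 2 := by
  have h_pos := lorentzFactor_pos hp
  field_simp
  linear_combination -lorentzFactor_sq_mul hp

variable [DecidableEq ι]

theorem isSymm_sqrtInvMetric (p : ι → ℝ) : (sqrtInvMetric p).IsSymm :=
  isSymm_one.add (IsSymm.smul (transpose_vecMulVec p p) _)

theorem sqrtInvMetric_mul_self (hp : p ⬝ᵥ p < 1) :
    sqrtInvMetric p * sqrtInvMetric p = 1 + lorentzFactor p ^ 2 • vecMulVec p p := by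
  rw [← sqrtInvMetric_coeff hp, sqrtInvMetric]
  simp only [mul_add, add_mul, one_mul, mul_one, Matrix.smul_mul, Matrix.mul_smul,
    vecMulVec_self_mul_self]
  module

theorem metric_mul_sqrtInvMetric_sq (hp : p ⬝ᵥ p < 1) :
    (1 - vecMulVec p p) * (sqrtInvMetric p * sqrtInvMetric p) = 1 := by
  have h_coeff : lorentzFactor p ^ 2 * (p ⬝ᵥ p) = lorentzFactor p ^ 2 - 1 := by
    linarith [lorentzFactor_sq_mul hp]
  rw [sqrtInvMetric_mul_self hp]
  simp only [mul_add, sub_mul, one_mul, mul_one, Matrix.mul_smul, vecMulVec_self_mul_self,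
    smul_smul, h_coeff]
  module

theorem isUnit_sqrtInvMetric (hp : p ⬝ᵥ p < 1) : IsUnit (sqrtInvMetric p) :=
  IsUnit.of_mul_eq_one_right _ ((mul_assoc _ _ _).trans (metric_mul_sqrtInvMetric_sq hp))

/-- The symmetric matrix `g^{-1/2} h g^{-1/2}` of the second fundamental form, for the gradient `p`
and the Hessian `A`. -/
noncomputable def shapeMatrix (p : ι → ℝ) : Matrix ι ι ℝ →ₗ[ℝ] Matrix ι ι ℝ :=
  lorentzFactor p •
    (LinearMap.mulRight ℝ (sqrtInvMetric p)).comp (LinearMap.mulLeft ℝ (sqrtInvMetric p))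

theorem shapeMatrix_apply (p : ι → ℝ) (A : Matrix ι ι ℝ) :
    shapeMatrix p A = lorentzFactor p • (sqrtInvMetric p * A * sqrtInvMetric p) := rfl

theorem isSymm_shapeMatrix (p : ι → ℝ) {A : Matrix ι ι ℝ} (hA : A.IsSymm) :
    (shapeMatrix p A).IsSymm := by
  rw [IsSymm, shapeMatrix_apply, transpose_smul, transpose_mul, transpose_mul, hA,
    isSymm_sqrtInvMetric, mul_assoc]

theorem posSemidef_shapeMatrix (hp : p ⬝ᵥ p < 1) {S : Matrix ι ι ℝ} (hS : S.PosSemidef) :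
    (shapeMatrix p S).PosSemidef := by
  have h_conj := hS.mul_mul_conjTranspose_same (sqrtInvMetric p)
  rw [conjTranspose_eq_transpose_of_trivial, isSymm_sqrtInvMetric] at h_conj
  exact h_conj.smul (lorentzFactor_pos hp).le

theorem shapeMatrix_injective (hp : p ⬝ᵥ p < 1) : Function.Injective (shapeMatrix p) := by
  refine (injective_iff_map_eq_zero (shapeMatrix p)).2 fun S h => ?_
  rwa [shapeMatrix_apply, smul_eq_zero_iff_right (lorentzFactor_pos hp).ne',
    (isUnit_sqrtInvMetric hp).mul_left_eq_zero, (isUnit_sqrtInvMetric hp).mul_right_eq_zero] at h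

theorem shapeMatrix_smul_of_eigenvector {A : Matrix ι ι ℝ} (hA : A.IsSymm) {b : ℝ}
    (hAp : A *ᵥ p = (-b) • p) {c : ℝ} (hc : (c • p) ⬝ᵥ (c • p) < 1) :
    shapeMatrix (c • p) A = lorentzFactor (c • p) • A -
      (b * (lorentzFactor (c • p) ^ 3 * c ^ 2)) • vecMulVec p p := by
  have h_left : A * vecMulVec p p = (-b) • vecMulVec p p := by
    rw [mul_vecMulVec, hAp, smul_vecMulVec]
  have h_right : vecMulVec p p * A = (-b) • vecMulVec p p := by
    rw [vecMulVec_mul, ← mulVec_transpose, hA, hAp, vecMulVec_smul]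
  have h_coeff := sqrtInvMetric_coeff hc
  rw [shapeMatrix_apply, sqrtInvMetric]
  set w := lorentzFactor (c • p)
  set β := w ^ 2 / (w + 1)
  have h_cube : b * (w ^ 3 * c ^ 2) =
      w * b * c ^ 2 * (2 * β + β ^ 2 * (c ^ 2 * (p ⬝ᵥ p))) := by
    simp only [smul_dotProduct, dotProduct_smul, smul_eq_mul] at h_coeff
    linear_combination -w * b * c ^ 2 * h_coeff
  rw [h_cube]
  simp only [smul_vecMulVec, vecMulVec_smul, mul_add, add_mul, one_mul, mul_one, Matrix.smul_mul,
    Matrix.mul_smul, h_left, h_right, vecMulVec_self_mul_self]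
  module

theorem shapeMatrix_of_eigenvector {A : Matrix ι ι ℝ} (hp : p ⬝ᵥ p < 1) (hA : A.IsSymm) {b : ℝ}
    (hAp : A *ᵥ p = (-b) • p) :
    shapeMatrix p A = lorentzFactor p • A - (b * lorentzFactor p ^ 3) • vecMulVec p p := by
  simpa using shapeMatrix_smul_of_eigenvector hA hAp (c := 1) (by simpa using hp)

theorem shapeMatrix_vecMulVec_self (hp : p ⬝ᵥ p < 1) :
    shapeMatrix p (vecMulVec p p) = lorentzFactor p ^ 3 • vecMulVec p p := by
  rw [shapeMatrix_of_eigenvector hp (transpose_vecMulVec p p) (b := -(p ⬝ᵥ p))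
    (by rw [vecMulVec_mulVec, neg_neg, op_smul_eq_smul]), ← sub_smul]
  congr 1
  linear_combination -lorentzFactor p * lorentzFactor_sq_mul hp

end ShapeMatrix

section CurvatureOperator

open Matrix
open scoped Matrix.Norms.Operator

variable {ι : Type*} [Fintype ι] [DecidableEq ι] {p : ι → ℝ}

theorem contDiffAt_sqrtInvMetric {r : WithTop ℕ∞} (hp : p ⬝ᵥ p < 1) :
    ContDiffAt ℝ r sqrtInvMetric p := by
  have h_factor := contDiffAt_lorentzFactor (r := r) hp
  have h_coeff := (h_factor.pow 2).div (h_factor.add contDiffAt_const)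
    (add_pos (lorentzFactor_pos hp) one_pos).ne'
  have h_outer : ContDiffAt ℝ r (fun q : ι → ℝ => vecMulVec q q) p :=
    contDiffAt_matrix fun i j => (contDiffAt_apply ℝ ℝ i p).mul (contDiffAt_apply ℝ ℝ j p)
  exact contDiffAt_const.add (h_coeff.smul h_outer)

theorem contDiffAt_shapeMatrix {r : WithTop ℕ∞} {z : (ι → ℝ) × Matrix ι ι ℝ}
    (hz : z.1 ⬝ᵥ z.1 < 1) :
    ContDiffAt ℝ r (fun y : (ι → ℝ) × Matrix ι ι ℝ =>
      complementaryMatrix (shapeMatrix y.1 y.2)) z := by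
  have h_root := (contDiffAt_sqrtInvMetric hz).comp z (contDiffAt_fst (n := r))
  have h_shape := ((contDiffAt_lorentzFactor hz).comp z (contDiffAt_fst (n := r))).smul
    ((h_root.mul contDiffAt_snd).mul h_root)
  exact (LinearMap.toContinuousLinearMap complementaryMatrix).contDiff.contDiffAt.comp z h_shape

theorem hasDerivAt_shapeMatrix_ray {A : Matrix ι ι ℝ} (hp : p ⬝ᵥ p < 1) (hA : A.IsSymm) {b : ℝ}
    (hAp : A *ᵥ p = (-b) • p) :
    HasDerivAt (fun t : ℝ => shapeMatrix ((1 + t) • p) A)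
      ((lorentzFactor p ^ 2 * (p ⬝ᵥ p)) • shapeMatrix p A -
        (2 * lorentzFactor p ^ 2 * b) • shapeMatrix p (vecMulVec p p)) 0 := by
  have h_factor := hasDerivAt_lorentzFactor_ray hp
  have h_coeff := ((h_factor.fun_pow 3).mul
    (((hasDerivAt_id (0 : ℝ)).const_add 1).pow 2)).const_mul b
  have h_ray : ∀ᶠ t : ℝ in nhds 0, ((1 + t) • p) ⬝ᵥ ((1 + t) • p) < 1 := by
    have h_cont : Continuous fun t : ℝ => ((1 + t) • p) ⬝ᵥ ((1 + t) • p) := by fun_prop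
    exact h_cont.continuousAt.eventually (gt_mem_nhds (by simpa using hp))
  refine (((h_factor.smul_const A).sub
    (h_coeff.smul_const (vecMulVec p p))).congr_of_eventuallyEq ?_).congr_deriv ?_
  · filter_upwards [h_ray] with t ht
    exact shapeMatrix_smul_of_eigenvector hA hAp ht
  · rw [shapeMatrix_of_eigenvector hp hA hAp, shapeMatrix_vecMulVec_self hp, smul_sub, smul_smul,
      smul_smul, smul_smul, sub_sub, ← add_smul]
    congr 2
    · ring
    · simp only [Nat.cast_ofNat, add_zero, one_smul, Nat.add_one_sub_one, id_eq, Pi.pow_apply,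
        one_pow, mul_one]
      linear_combination -2 * b * lorentzFactor p ^ 3 * lorentzFactor_sq_mul hp

/-- The curvature operator `(σ_k / σ_l)(λ(η))` as a function of the gradient and the Hessian. -/
noncomputable def curvatureOperator (k l : ℕ) (z : (ι → ℝ) × Matrix ι ι ℝ) : ℝ :=
  sigmaQuotient k l (complementaryMatrix (shapeMatrix z.1 z.2))

/-- Admissibility of a pair (gradient, Hessian). -/
structure AdmissiblePair (k : ℕ) (p : ι → ℝ) (A : Matrix ι ι ℝ) : Prop where
  lt_one : p ⬝ᵥ p < 1
  symm : A.IsSymm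
  gamma : IsGamma k (complementaryMatrix (shapeMatrix p A))

namespace AdmissiblePair

variable {k l : ℕ} {A S : Matrix ι ι ℝ}

theorem eventually (h : AdmissiblePair k p A) :
    ∀ᶠ z : (ι → ℝ) × Matrix ι ι ℝ in nhds (p, A), z.2.IsSymm → AdmissiblePair k z.1 z.2 := by
  have h_lt : ∀ᶠ z : (ι → ℝ) × Matrix ι ι ℝ in nhds (p, A), z.1 ⬝ᵥ z.1 < 1 := by
    have h_cont : Continuous fun z : (ι → ℝ) × Matrix ι ι ℝ => z.1 ⬝ᵥ z.1 := by fun_prop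
    exact h_cont.continuousAt.eventually (gt_mem_nhds h.lt_one)
  have h_gamma : ∀ᶠ z : (ι → ℝ) × Matrix ι ι ℝ in nhds (p, A),
      ∀ m ∈ Finset.Icc 1 k, 0 < sigma m (complementaryMatrix (shapeMatrix z.1 z.2)) := by
    rw [Filter.eventually_all_finset]
    intro m hm
    rw [Finset.mem_Icc] at hm
    exact ((contDiff_sigma m).contDiffAt.comp (p, A)
      (contDiffAt_shapeMatrix (r := 0) (z := (p, A)) h.lt_one)).continuousAt.eventually
        (lt_mem_nhds (h.gamma m hm.1 hm.2))
  filter_upwards [h_lt, h_gamma] with z hz_lt hz_gamma hz_symm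
  exact ⟨hz_lt, hz_symm, fun m hm hmk => hz_gamma m (Finset.mem_Icc.2 ⟨hm, hmk⟩)⟩

variable (hlk : l < k) (h : AdmissiblePair k p A)

include hlk h

theorem contDiffAt {r : WithTop ℕ∞} : ContDiffAt ℝ r (curvatureOperator k l) (p, A) :=
  (h.gamma.contDiffAt_sigmaQuotient hlk).comp (p, A) (contDiffAt_shapeMatrix h.lt_one)

theorem hasFDerivAt :
    HasFDerivAt (curvatureOperator k l) (fderiv ℝ (curvatureOperator k l) (p, A)) (p, A) :=
  ((h.contDiffAt hlk).differentiableAt one_ne_zero).hasFDerivAt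

theorem fderiv_hessian (S : Matrix ι ι ℝ) :
    fderiv ℝ (curvatureOperator k l) (p, A) (0, S) =
      fderiv ℝ (sigmaQuotient k l) (complementaryMatrix (shapeMatrix p A))
        (complementaryMatrix (shapeMatrix p S)) := by
  have h_line : HasDerivAt (fun t : ℝ => sigmaQuotient k l (complementaryMatrix (shapeMatrix p A) +
      t • complementaryMatrix (shapeMatrix p S))) _ 0 :=
    (h.gamma.hasFDerivAt_sigmaQuotient hlk).hasLineDerivAt _
  refine ((h.hasFDerivAt hlk).hasLineDerivAt (0, S)).unique
    (h_line.congr_of_eventuallyEq (.of_forall fun t => ?_))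
  simp [curvatureOperator]

theorem fderiv_pos (hS : S.PosSemidef) (hS0 : S ≠ 0) :
    0 < fderiv ℝ (curvatureOperator k l) (p, A) (0, S) := by
  have := h.gamma.nontrivial (by lia)
  rw [h.fderiv_hessian hlk]
  exact h.gamma.fderiv_pos hlk (isSymm_complementaryMatrix (isSymm_shapeMatrix p h.symm))
    (posSemidef_complementaryMatrix (posSemidef_shapeMatrix h.lt_one hS))
    (by rwa [map_ne_zero_iff _ complementaryMatrix_injective,
      map_ne_zero_iff _ (shapeMatrix_injective h.lt_one)])

theorem fderiv_nonneg (hS : S.PosSemidef) :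
    0 ≤ fderiv ℝ (curvatureOperator k l) (p, A) (0, S) := by
  rcases eq_or_ne S 0 with rfl | hS0
  · rw [Prod.mk_zero_zero, map_zero]
  · exact (h.fderiv_pos hlk hS hS0).le

theorem fderiv_self :
    fderiv ℝ (curvatureOperator k l) (p, A) (0, A) =
      ((k - l : ℕ) : ℝ) * curvatureOperator k l (p, A) := by
  rw [h.fderiv_hessian hlk, h.gamma.fderiv_self hlk, curvatureOperator]

theorem le_add (hS : S.PosSemidef) :
    curvatureOperator k l (p, A) ≤ curvatureOperator k l (p, A + S) := by
  have h_le := (h.gamma.add_posSemidef hlk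
    (isSymm_complementaryMatrix (isSymm_shapeMatrix p h.symm))
    (posSemidef_complementaryMatrix (posSemidef_shapeMatrix h.lt_one hS))).2
  simpa only [curvatureOperator, map_add] using h_le

theorem fderiv_gradient {b : ℝ} (hAp : A *ᵥ p = (-b) • p) :
    fderiv ℝ (curvatureOperator k l) (p, A) (p, 0) =
      lorentzFactor p ^ 2 * (p ⬝ᵥ p) * (((k - l : ℕ) : ℝ) * curvatureOperator k l (p, A)) -
        2 * lorentzFactor p ^ 2 * b *
          fderiv ℝ (curvatureOperator k l) (p, A) (0, vecMulVec p p) := by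
  set M' := (lorentzFactor p ^ 2 * (p ⬝ᵥ p)) • shapeMatrix p A -
    (2 * lorentzFactor p ^ 2 * b) • shapeMatrix p (vecMulVec p p)
  have h_comp := (LinearMap.toContinuousLinearMap
    (complementaryMatrix (ι := ι))).hasFDerivAt.comp_hasDerivAt (0 : ℝ)
      (hasDerivAt_shapeMatrix_ray h.lt_one h.symm hAp)
  have h_quot := (h.gamma.hasFDerivAt_sigmaQuotient hlk).comp_hasDerivAt_of_eq (0 : ℝ) h_comp
    (by simp)
  have h_value : fderiv ℝ (curvatureOperator k l) (p, A) (p, 0) =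
      fderiv ℝ (sigmaQuotient k l) (complementaryMatrix (shapeMatrix p A))
        (complementaryMatrix M') := by
    refine ((h.hasFDerivAt hlk).hasLineDerivAt (p, 0)).unique
      (h_quot.congr_of_eventuallyEq (.of_forall fun t => ?_))
    simp [curvatureOperator, add_smul]
  rw [h_value, map_sub, map_smul, map_smul, map_sub, map_smul, map_smul,
    ← h.fderiv_hessian hlk, ← h.fderiv_hessian hlk, h.fderiv_self hlk, smul_eq_mul, smul_eq_mul]

/-- At an interior maximum of `log w + B u`, where `w` is the Lorentz factor of `Du`,
`-B (1 - |p|²) p` is the derivative of the gradient and `T` that of the Hessian in the direction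
`p = Du`. -/
theorem fderiv_le {B : ℝ} (hAp : A *ᵥ p = (-(B * (1 - p ⬝ᵥ p))) • p) {T : Matrix ι ι ℝ}
    (hT : (-(T + A * A + (1 - p ⬝ᵥ p) • ((2 * B ^ 2) • vecMulVec p p + B • A))).PosSemidef) :
    fderiv ℝ (curvatureOperator k l) (p, A) ((-(B * (1 - p ⬝ᵥ p))) • p, T) ≤
      -(B * (((k - l : ℕ) : ℝ) * curvatureOperator k l (p, A))) := by
  set q := 1 - p ⬝ᵥ p with hq
  have h_factor : lorentzFactor p ^ 2 * q = 1 := lorentzFactor_sq_mul h.lt_one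
  have h_square : (A * A).PosSemidef := by
    have := posSemidef_self_mul_conjTranspose A
    rwa [conjTranspose_eq_transpose_of_trivial, h.symm] at this
  have h_square_nonneg := h.fderiv_nonneg hlk h_square
  have h_second_order := h.fderiv_nonneg hlk hT
  have h_self := h.fderiv_self hlk
  have h_gradient := h.fderiv_gradient hlk hAp
  set L := fderiv ℝ (curvatureOperator k l) (p, A)
  obtain ⟨D, hD⟩ : ∃ D : Matrix ι ι ℝ →ₗ[ℝ] ℝ, ∀ S, L (0, S) = D S :=
    ⟨L.toLinearMap.comp (LinearMap.inr ℝ (ι → ℝ) (Matrix ι ι ℝ)), fun _ => rfl⟩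
  have h_split : L ((-(B * q)) • p, T) = -(B * q) * L (p, 0) + D T := by
    have h_decomp : ((-(B * q)) • p, T) =
        (-(B * q)) • ((p, 0) : (ι → ℝ) × Matrix ι ι ℝ) + (0, T) := by simp
    rw [h_decomp, map_add, map_smul, smul_eq_mul, hD]
  have h_norm : p ⬝ᵥ p = 1 - q := by rw [hq]; ring
  rw [hD] at h_square_nonneg h_self h_gradient
  simp only [hD, map_neg, map_add, map_smul, smul_eq_mul] at h_second_order
  rw [h_split, h_gradient, ← h_self, h_norm]
  linear_combination h_square_nonneg + h_second_order +
    (2 * B ^ 2 * q * D (vecMulVec p p) - B * (1 - q) * D A) * h_factor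

end AdmissiblePair

end CurvatureOperator

/-! ### The curvature operator of a graph -/

section GraphGeometry

open Matrix

theorem roots_charpoly_diagonal {ι : Type*} [Fintype ι] [DecidableEq ι] (d : ι → ℝ) :
    (diagonal d).charpoly.roots = Finset.univ.val.map d := by
  rw [charpoly_diagonal, Polynomial.roots_prod _ _
    (Finset.prod_ne_zero_iff.2 fun i _ => Polynomial.X_sub_C_ne_zero _)]
  simp only [Polynomial.roots_X_sub_C, Multiset.bind_singleton]

theorem roots_charpoly_complementaryMatrix {ι : Type*} [Fintype ι] [DecidableEq ι]
    {W : Matrix ι ι ℝ} (hW : W.IsSymm) :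
    (complementaryMatrix W).charpoly.roots = complementarySums W.charpoly.roots := by
  obtain ⟨U, d, hU, rfl⟩ := exists_orthogonal_diagonalization hW
  have h_conj : complementaryMatrix (U * diagonal d * Uᵀ) =
      U * diagonal (fun i => ∑ j, d j - d i) * Uᵀ := by
    rw [← diagonal_sub, ← smul_one_eq_diagonal, mul_sub, sub_mul, Matrix.mul_smul, mul_one,
      Matrix.smul_mul, mul_eq_one_comm.1 hU, complementaryMatrix_apply, trace_mul_comm, ← mul_assoc,
      hU, one_mul, trace_diagonal]
  rw [h_conj, charpoly_conj hU, charpoly_conj hU, roots_charpoly_diagonal, roots_charpoly_diagonal,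
    complementarySums, Multiset.map_map]
  rfl

variable {n : ℕ}

/-- The gradient `Du` as a coordinate vector, that is, without the Euclidean norm on its type. -/
noncomputable def gradVec (u : EuclideanSpace ℝ (Fin n) → ℝ) (x : EuclideanSpace ℝ (Fin n)) :
    Fin n → ℝ := (gradient u x).ofLp

theorem gradVec_dotProduct_self (u : EuclideanSpace ℝ (Fin n) → ℝ)
    (x : EuclideanSpace ℝ (Fin n)) : gradVec u x ⬝ᵥ gradVec u x = ‖gradient u x‖ ^ 2 := by
  simp only [EuclideanSpace.real_norm_sq_eq, gradVec, dotProduct, ← sq]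

theorem metric_eq (u : EuclideanSpace ℝ (Fin n) → ℝ) (x : EuclideanSpace ℝ (Fin n)) :
    metric u x = 1 - vecMulVec (gradVec u x) (gradVec u x) := by
  ext i j
  simp only [metric, gradVec, of_apply, Matrix.sub_apply, one_apply, vecMulVec_apply]

theorem secondFundamentalForm_eq (u : EuclideanSpace ℝ (Fin n) → ℝ)
    (x : EuclideanSpace ℝ (Fin n)) :
    secondFundamentalForm u x = lorentzFactor (gradVec u x) • hessian u x := by
  ext i j
  simp [secondFundamentalForm, lorentzFactor, gradVec_dotProduct_self, div_eq_inv_mul]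

variable {u : EuclideanSpace ℝ (Fin n) → ℝ} {x : EuclideanSpace ℝ (Fin n)}

theorem inv_metric_eq (hp : gradVec u x ⬝ᵥ gradVec u x < 1) :
    (metric u x)⁻¹ = sqrtInvMetric (gradVec u x) * sqrtInvMetric (gradVec u x) := by
  rw [metric_eq]
  exact inv_eq_right_inv (metric_mul_sqrtInvMetric_sq hp)

theorem shapeMatrix_hessian_eq :
    shapeMatrix (gradVec u x) (hessian u x) =
      sqrtInvMetric (gradVec u x) * secondFundamentalForm u x * sqrtInvMetric (gradVec u x) := by
  rw [shapeMatrix_apply, secondFundamentalForm_eq, Matrix.mul_smul, Matrix.smul_mul]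

theorem principalCurvatures_eq_roots (hp : gradVec u x ⬝ᵥ gradVec u x < 1) :
    principalCurvatures u x = (shapeMatrix (gradVec u x) (hessian u x)).charpoly.roots := by
  rw [principalCurvatures, eigenvaluesWrt, inv_metric_eq hp, shapeMatrix_hessian_eq, mul_assoc,
    charpoly_mul_comm]

theorem meanCurvature_eq_trace (hp : gradVec u x ⬝ᵥ gradVec u x < 1) :
    meanCurvature u x = (shapeMatrix (gradVec u x) (hessian u x)).trace := by
  rw [meanCurvature, inv_metric_eq hp, shapeMatrix_hessian_eq, mul_assoc, trace_mul_comm]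

theorem eigenvaluesWrt_etaTensor (hp : gradVec u x ⬝ᵥ gradVec u x < 1) :
    eigenvaluesWrt (metric u x) (etaTensor u x) =
      (complementaryMatrix (shapeMatrix (gradVec u x) (hessian u x))).charpoly.roots := by
  have h_conj : sqrtInvMetric (gradVec u x) * metric u x * sqrtInvMetric (gradVec u x) = 1 := by
    rw [mul_eq_one_comm, ← mul_assoc, metric_eq]
    exact mul_eq_one_comm.1 (metric_mul_sqrtInvMetric_sq hp)
  rw [eigenvaluesWrt, inv_metric_eq hp, mul_assoc, charpoly_mul_comm, etaTensor,
    meanCurvature_eq_trace hp, mul_sub, sub_mul, Matrix.mul_smul, Matrix.smul_mul, h_conj,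
    complementaryMatrix_apply, shapeMatrix_hessian_eq]

theorem splits_charpoly_complementaryMatrix {ι : Type*} [Fintype ι] [DecidableEq ι]
    {W : Matrix ι ι ℝ} (hW : W.IsSymm) : (complementaryMatrix W).charpoly.Splits :=
  (isHermitian_iff_isSymm.2 (isSymm_complementaryMatrix hW)).splits_charpoly

theorem quotientCurvature_eq_curvatureOperator (k l : ℕ) (hp : gradVec u x ⬝ᵥ gradVec u x < 1)
    (hA : (hessian u x).IsSymm) :
    quotientCurvature k l u x = curvatureOperator k l (gradVec u x, hessian u x) := by
  have h_splits := splits_charpoly_complementaryMatrix (isSymm_shapeMatrix (gradVec u x) hA)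
  rw [quotientCurvature, eigenvaluesWrt_etaTensor hp, curvatureOperator, sigmaQuotient,
    sigma_eq_esymm_roots h_splits, sigma_eq_esymm_roots h_splits]

theorem admissiblePair_of_principalCurvatures_mem {k : ℕ} (hp : gradVec u x ⬝ᵥ gradVec u x < 1)
    (hA : (hessian u x).IsSymm) (h : principalCurvatures u x ∈ gammaTildeCone k) :
    AdmissiblePair k (gradVec u x) (hessian u x) := by
  have h_shape := isSymm_shapeMatrix (gradVec u x) hA
  refine ⟨hp, hA, fun m hm hmk => ?_⟩
  rw [sigma_eq_esymm_roots (splits_charpoly_complementaryMatrix h_shape),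
    roots_charpoly_complementaryMatrix h_shape, ← principalCurvatures_eq_roots hp]
  exact h m hm hmk

end GraphGeometry

/-! ### Directional derivatives of the gradient and the Hessian -/

section LineDerivatives

open scoped Topology

variable {E F : Type*} [NormedAddCommGroup E] [NormedSpace ℝ E]

theorem eventually_line {P : E → Prop} {x : E} (h : ∀ᶠ y in 𝓝 x, P y) (v : E) :
    ∀ᶠ t : ℝ in 𝓝 0, P (x + t • v) := by
  have h_cont : ContinuousAt (fun t : ℝ => x + t • v) 0 := by fun_prop
  exact h_cont.eventually (by simpa using h)

theorem second_order_of_isLocalMax_real {f f' : ℝ → ℝ} {t₀ c : ℝ}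
    (hf : ∀ᶠ t in 𝓝 t₀, HasDerivAt f (f' t) t) (hf' : HasDerivAt f' c t₀)
    (hmax : IsLocalMax f t₀) : f' t₀ = 0 ∧ c ≤ 0 := by
  have h_first : f' t₀ = 0 := hmax.hasDerivAt_eq_zero hf.self_of_nhds
  refine ⟨h_first, ?_⟩
  by_contra! hc
  have h_deriv : deriv f =ᶠ[𝓝 t₀] f' := hf.mono fun t ht => ht.deriv
  have h_second : deriv (deriv f) t₀ = c := h_deriv.deriv_eq.trans hf'.deriv
  have hmin : IsLocalMin f t₀ := isLocalMin_of_deriv_deriv_pos (h_second ▸ hc)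
    (h_deriv.self_of_nhds.trans h_first) hf.self_of_nhds.continuousAt
  have h_const : f =ᶠ[𝓝 t₀] fun _ => f t₀ := by
    filter_upwards [hmin, hmax] with t h_ge h_le
    exact le_antisymm h_le h_ge
  have h_zero : deriv (deriv f) t₀ = 0 := by
    rw [h_const.deriv.deriv_eq]
    simp only [deriv_const', deriv_const]
  exact hc.ne (h_zero.symm.trans h_second)

theorem second_order_of_isLocalMax {f f' : E → ℝ} {x v : E} {c : ℝ}
    (hf : ∀ᶠ y in 𝓝 x, HasLineDerivAt ℝ f (f' y) y v) (hf' : HasLineDerivAt ℝ f' c x v)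
    (hmax : IsLocalMax f x) : f' x = 0 ∧ c ≤ 0 := by
  have h_max : IsLocalMax (fun t : ℝ => f (x + t • v)) 0 := by
    simpa only [IsLocalMax, IsMaxFilter, zero_smul, add_zero] using eventually_line hmax v
  have h_deriv : ∀ᶠ t : ℝ in 𝓝 0,
      HasDerivAt (fun s : ℝ => f (x + s • v)) (f' (x + t • v)) t := by
    filter_upwards [eventually_line hf v] with t ht
    have h_shift : HasDerivAt (fun s : ℝ => f (x + t • v + (s - t) • v)) (f' (x + t • v)) t :=
      HasDerivAt.comp_sub_const t t (by simpa [HasLineDerivAt] using ht)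
    exact h_shift.congr_of_eventuallyEq (.of_forall fun s => congrArg f (by module))
  simpa only [zero_smul, add_zero] using second_order_of_isLocalMax_real h_deriv hf' h_max

end LineDerivatives

section Derivatives

open Matrix
open scoped Matrix.Norms.Operator Topology

variable {n : ℕ} {u : EuclideanSpace ℝ (Fin n) → ℝ} {x v : EuclideanSpace ℝ (Fin n)}

theorem bilinear_apply_eq_dotProduct
    (f : EuclideanSpace ℝ (Fin n) →L[ℝ] EuclideanSpace ℝ (Fin n) →L[ℝ] ℝ)
    (v w : EuclideanSpace ℝ (Fin n)) :
    f v w = v.ofLp ⬝ᵥ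
      (of fun i j => f (EuclideanSpace.single i 1) (EuclideanSpace.single j 1)) *ᵥ w.ofLp := by
  conv_lhs =>
    rw [← (EuclideanSpace.basisFun (Fin n) ℝ).sum_repr v,
      ← (EuclideanSpace.basisFun (Fin n) ℝ).sum_repr w]
  simp only [map_sum, map_smul, _root_.sum_apply, _root_.smul_apply, smul_eq_mul, dotProduct,
    mulVec, of_apply, Finset.mul_sum, EuclideanSpace.basisFun_repr, EuclideanSpace.basisFun_apply]
  rw [Finset.sum_comm]
  exact Finset.sum_congr rfl fun i _ => Finset.sum_congr rfl fun j _ => by ring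

theorem gradVec_apply (u : EuclideanSpace ℝ (Fin n) → ℝ) (x : EuclideanSpace ℝ (Fin n))
    (i : Fin n) : gradVec u x i = fderiv ℝ u x (EuclideanSpace.single i 1) := by
  rw [← inner_gradient_left, EuclideanSpace.inner_single_right]
  simp [gradVec]

theorem fderiv_eq_dotProduct (u : EuclideanSpace ℝ (Fin n) → ℝ)
    (x v : EuclideanSpace ℝ (Fin n)) : fderiv ℝ u x v = gradVec u x ⬝ᵥ v.ofLp := by
  rw [← inner_gradient_left, EuclideanSpace.inner_eq_star_dotProduct, star_trivial,
    dotProduct_comm, gradVec]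

theorem isSymm_hessian (hu : ContDiffAt ℝ 2 u x) : (hessian u x).IsSymm :=
  IsSymm.ext fun _ _ => hu.isSymmSndFDerivAt (by simp) _ _

theorem hasLineDerivAt_gradVec (hu : ContDiffAt ℝ 2 u x) (v : EuclideanSpace ℝ (Fin n)) :
    HasLineDerivAt ℝ (gradVec u) (hessian u x *ᵥ v.ofLp) x v := by
  have h_line := ((hu.fderiv_right (m := 1) le_rfl).differentiableAt
    one_ne_zero).hasFDerivAt.hasLineDerivAt v
  refine hasDerivAt_pi.2 fun i => ?_
  have h_entry := h_line.clm_apply (hasDerivAt_const (0 : ℝ) (EuclideanSpace.single i (1 : ℝ)))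
  simp only [gradVec_apply]
  refine h_entry.congr_deriv ?_
  rw [map_zero, add_zero, (hu.isSymmSndFDerivAt (by simp)) v, bilinear_apply_eq_dotProduct]
  exact single_one_dotProduct _ _

/-- The derivative of the Hessian in the direction `v`. -/
noncomputable def hessianDeriv (u : EuclideanSpace ℝ (Fin n) → ℝ)
    (x v : EuclideanSpace ℝ (Fin n)) : Matrix (Fin n) (Fin n) ℝ :=
  of fun i j => fderiv ℝ (fderiv ℝ (fderiv ℝ u)) x v
    (EuclideanSpace.single i 1) (EuclideanSpace.single j 1)

theorem hasLineDerivAt_hessian (hu : ContDiffAt ℝ 3 u x) (v : EuclideanSpace ℝ (Fin n)) :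
    HasLineDerivAt ℝ (hessian u) (hessianDeriv u x v) x v := by
  have h_diff : DifferentiableAt ℝ (fderiv ℝ (fderiv ℝ u)) x :=
    ((hu.fderiv_right (m := 2) le_rfl).fderiv_right (m := 1) le_rfl).differentiableAt one_ne_zero
  refine hasDerivAt_matrix fun i j => ?_
  have h_entry := (h_diff.hasFDerivAt.clm_apply
    (hasFDerivAt_const (EuclideanSpace.single i (1 : ℝ)) x)).clm_apply
      (hasFDerivAt_const (EuclideanSpace.single j (1 : ℝ)) x)
  refine (h_entry.hasLineDerivAt v).congr_deriv ?_
  simp [hessianDeriv]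

theorem isSymm_hessianDeriv (hu : ContDiffAt ℝ 3 u x) (v : EuclideanSpace ℝ (Fin n)) :
    (hessianDeriv u x v).IsSymm := by
  have h_line := hasLineDerivAt_hessian hu v
  have h_transpose := (LinearMap.toContinuousLinearMap
    (transposeLinearEquiv (Fin n) (Fin n) ℝ ℝ).toLinearMap).hasFDerivAt.comp_hasDerivAt
      (0 : ℝ) h_line
  refine h_transpose.unique (HasDerivAt.congr_of_eventuallyEq h_line ?_)
  filter_upwards [eventually_line ((hu.of_le (m := 2) (by norm_num)).eventually (by simp)) v]
    with t ht
  exact isSymm_hessian ht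

theorem hessianDeriv_mulVec_comm (hu : ContDiffAt ℝ 3 u x) (v p : EuclideanSpace ℝ (Fin n)) :
    p.ofLp ⬝ᵥ hessianDeriv u x v *ᵥ v.ofLp = v.ofLp ⬝ᵥ hessianDeriv u x p *ᵥ v.ofLp := by
  have h_symm := (hu.fderiv_right (m := 2) le_rfl).isSymmSndFDerivAt (by simp) p v
  rw [hessianDeriv, ← bilinear_apply_eq_dotProduct, hessianDeriv, ← bilinear_apply_eq_dotProduct,
    h_symm]

theorem hasLineDerivAt_dotProduct {f g : EuclideanSpace ℝ (Fin n) → Fin n → ℝ}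
    {f' g' : Fin n → ℝ}
    (hf : HasLineDerivAt ℝ f f' x v) (hg : HasLineDerivAt ℝ g g' x v) :
    HasLineDerivAt ℝ (fun y => f y ⬝ᵥ g y) (f' ⬝ᵥ g x + f x ⬝ᵥ g') x v := by
  have h_sum := HasDerivAt.fun_sum (u := Finset.univ) fun i _ =>
    (hasDerivAt_pi.1 hf i).fun_mul (hasDerivAt_pi.1 hg i)
  simpa only [zero_smul, add_zero, Finset.sum_add_distrib] using! h_sum

theorem hasLineDerivAt_mulVec {f : EuclideanSpace ℝ (Fin n) → Matrix (Fin n) (Fin n) ℝ}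
    {f' : Matrix (Fin n) (Fin n) ℝ} (hf : HasLineDerivAt ℝ f f' x v) (w : Fin n → ℝ) :
    HasLineDerivAt ℝ (fun y => f y *ᵥ w) (f' *ᵥ w) x v := by
  have h_comp := (LinearMap.toContinuousLinearMap
    ((mulVecBilin ℝ ℝ).flip w)).hasFDerivAt.comp_hasDerivAt (0 : ℝ) hf
  exact h_comp

theorem hessian_nonpos_of_isLocalMax (hu : ContDiffAt ℝ 2 u x) (hmax : IsLocalMax u x) :
    gradVec u x = 0 ∧ ∀ w : Fin n → ℝ, w ⬝ᵥ hessian u x *ᵥ w ≤ 0 := by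
  refine ⟨?_, fun w => ?_⟩
  · ext i
    rw [gradVec_apply, hmax.fderiv_eq_zero, _root_.zero_apply, Pi.zero_apply]
  · have h_first : ∀ᶠ y in 𝓝 x,
        HasLineDerivAt ℝ u (gradVec u y ⬝ᵥ w) y (WithLp.toLp 2 w) := by
      filter_upwards [hu.eventually (by simp)] with y hy
      rw [← fderiv_eq_dotProduct u y (WithLp.toLp 2 w)]
      exact (hy.differentiableAt two_ne_zero).hasFDerivAt.hasLineDerivAt _
    have h_second := hasLineDerivAt_dotProduct (hasLineDerivAt_gradVec hu (WithLp.toLp 2 w))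
      (g := fun _ => w) (hasDerivAt_const (0 : ℝ) w)
    rw [dotProduct_zero, add_zero, dotProduct_comm] at h_second
    exact (second_order_of_isLocalMax h_first h_second hmax).2

end Derivatives

/-! ### The interior gradient estimate -/

section TestFunction

open Matrix
open scoped Matrix.Norms.Operator Topology

variable {n : ℕ} {u : EuclideanSpace ℝ (Fin n) → ℝ} {x : EuclideanSpace ℝ (Fin n)} {B : ℝ}

/-- The function `log w + B u`, with `w` the Lorentz factor of `Du`, to which the maximum principle
is applied. -/
noncomputable def testFunction (B : ℝ) (u : EuclideanSpace ℝ (Fin n) → ℝ)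
    (x : EuclideanSpace ℝ (Fin n)) : ℝ :=
  Real.log (lorentzFactor (gradVec u x)) + B * u x

theorem continuousAt_gradVec (hu : ContDiffAt ℝ 1 u x) : ContinuousAt (gradVec u) x := by
  refine continuousAt_pi.2 fun i => ?_
  simp only [gradVec_apply]
  exact (hu.fderiv_right (m := 0) le_rfl).continuousAt.clm_apply continuousAt_const

theorem hasLineDerivAt_testFunction (hu : ContDiffAt ℝ 2 u x)
    (hp : gradVec u x ⬝ᵥ gradVec u x < 1) (w : Fin n → ℝ) :
    HasLineDerivAt ℝ (testFunction B u)
      ((gradVec u x ⬝ᵥ hessian u x *ᵥ w) / (1 - gradVec u x ⬝ᵥ gradVec u x) +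
        B * (gradVec u x ⬝ᵥ w)) x (WithLp.toLp 2 w) := by
  have h_gradient := hasLineDerivAt_gradVec hu (WithLp.toLp 2 w)
  have h_function : HasDerivAt (fun t : ℝ => u (x + t • WithLp.toLp 2 w)) _ 0 :=
    (hu.differentiableAt two_ne_zero).hasFDerivAt.hasLineDerivAt _
  have h_sqrt := HasDerivAt.sqrt
    (HasDerivAt.const_sub 1 (hasLineDerivAt_dotProduct h_gradient h_gradient))
    (by simpa using (sub_pos.2 hp).ne')
  have h_log := (h_sqrt.log (by simpa using (Real.sqrt_pos.2 (sub_pos.2 hp)).ne')).neg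
  refine ((h_log.add (h_function.const_mul B)).congr_of_eventuallyEq
    (.of_forall fun t => ?_)).congr_deriv ?_
  · simp [testFunction, lorentzFactor]
  · rw [zero_smul, add_zero, fderiv_eq_dotProduct, dotProduct_comm (hessian u x *ᵥ _), ← neg_div,
      ← neg_div, neg_neg, div_div, mul_assoc, Real.mul_self_sqrt (sub_pos.2 hp).le, ← two_mul,
      mul_div_mul_left _ _ two_ne_zero]

theorem testFunction_conditions_of_isLocalMax (hu : ContDiffAt ℝ 3 u x)
    (hp : gradVec u x ⬝ᵥ gradVec u x < 1) (hmax : IsLocalMax (testFunction B u) x)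
    (w : Fin n → ℝ) :
    gradVec u x ⬝ᵥ hessian u x *ᵥ w =
        -(B * (1 - gradVec u x ⬝ᵥ gradVec u x)) * (gradVec u x ⬝ᵥ w) ∧
      w ⬝ᵥ hessianDeriv u x (gradient u x) *ᵥ w + (hessian u x *ᵥ w) ⬝ᵥ (hessian u x *ᵥ w) +
        (1 - gradVec u x ⬝ᵥ gradVec u x) *
          (2 * B ^ 2 * (gradVec u x ⬝ᵥ w) ^ 2 + B * (w ⬝ᵥ hessian u x *ᵥ w)) ≤ 0 := by
  have hu₂ : ContDiffAt ℝ 2 u x := hu.of_le (by norm_num)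
  have h_cont : ContinuousAt (fun y => gradVec u y ⬝ᵥ gradVec u y) x := by
    have := continuousAt_gradVec (hu.of_le (by norm_num))
    fun_prop
  have h_first : ∀ᶠ y in 𝓝 x, HasLineDerivAt ℝ (testFunction B u)
      ((gradVec u y ⬝ᵥ hessian u y *ᵥ w) / (1 - gradVec u y ⬝ᵥ gradVec u y) +
        B * (gradVec u y ⬝ᵥ w)) y (WithLp.toLp 2 w) := by
    filter_upwards [hu₂.eventually (by simp), h_cont.eventually (gt_mem_nhds hp)] with y hy hpy
    exact hasLineDerivAt_testFunction hy hpy w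
  have h_gradient : HasLineDerivAt ℝ (gradVec u) (hessian u x *ᵥ w) x (WithLp.toLp 2 w) :=
    hasLineDerivAt_gradVec hu₂ (WithLp.toLp 2 w)
  have h_hessian := hasLineDerivAt_mulVec (hasLineDerivAt_hessian hu (WithLp.toLp 2 w)) w
  have h_second := HasDerivAt.add
    (HasDerivAt.div (hasLineDerivAt_dotProduct h_gradient h_hessian)
      (HasDerivAt.const_sub 1 (hasLineDerivAt_dotProduct h_gradient h_gradient))
      (by simpa using (sub_pos.2 hp).ne'))
    (HasDerivAt.const_mul B (hasLineDerivAt_dotProduct h_gradient (g := fun _ => w)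
      (hasDerivAt_const (0 : ℝ) w)))
  obtain ⟨h_eq, h_le⟩ := second_order_of_isLocalMax h_first h_second hmax
  have h_comm : gradVec u x ⬝ᵥ hessianDeriv u x (WithLp.toLp 2 w) *ᵥ w =
      w ⬝ᵥ hessianDeriv u x (gradient u x) *ᵥ w :=
    hessianDeriv_mulVec_comm hu (WithLp.toLp 2 w) (gradient u x)
  rw [zero_smul, add_zero, h_comm, dotProduct_comm (hessian u x *ᵥ w) (gradVec u x),
    dotProduct_comm (hessian u x *ᵥ w) w, dotProduct_zero, add_zero] at h_le
  have h_pos : 0 < 1 - gradVec u x ⬝ᵥ gradVec u x := sub_pos.2 hp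
  set q := 1 - gradVec u x ⬝ᵥ gradVec u x
  have h_critical : gradVec u x ⬝ᵥ hessian u x *ᵥ w = -(B * q) * (gradVec u x ⬝ᵥ w) := by
    field_simp at h_eq
    linear_combination h_eq
  beta_reduce at h_le
  rw [h_critical] at h_le
  refine ⟨h_critical, le_of_eq_of_le ?_ (mul_nonpos_of_nonneg_of_nonpos h_pos.le h_le)⟩
  field_simp
  ring

theorem hessian_mulVec_gradVec_of_isLocalMax (hu : ContDiffAt ℝ 3 u x)
    (hp : gradVec u x ⬝ᵥ gradVec u x < 1) (hmax : IsLocalMax (testFunction B u) x) :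
    hessian u x *ᵥ gradVec u x =
      (-(B * (1 - gradVec u x ⬝ᵥ gradVec u x))) • gradVec u x := by
  have hA : (hessian u x).IsSymm := isSymm_hessian (hu.of_le (by norm_num))
  refine dotProduct_eq _ _ fun w => ?_
  rw [← vecMul_transpose, hA, ← dotProduct_mulVec, smul_dotProduct, smul_eq_mul]
  exact (testFunction_conditions_of_isLocalMax hu hp hmax w).1

theorem posSemidef_of_isLocalMax_testFunction (hu : ContDiffAt ℝ 3 u x)
    (hp : gradVec u x ⬝ᵥ gradVec u x < 1) (hmax : IsLocalMax (testFunction B u) x) :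
    (-(hessianDeriv u x (gradient u x) + hessian u x * hessian u x +
      (1 - gradVec u x ⬝ᵥ gradVec u x) •
        ((2 * B ^ 2) • vecMulVec (gradVec u x) (gradVec u x) + B • hessian u x))).PosSemidef := by
  have hA : (hessian u x).IsSymm := isSymm_hessian (hu.of_le (by norm_num))
  have h_square_symm : (hessian u x * hessian u x).IsSymm := by rw [IsSymm, transpose_mul, hA]
  refine PosSemidef.of_dotProduct_mulVec_nonneg (isHermitian_iff_isSymm.2
    (((isSymm_hessianDeriv hu _).add h_square_symm).add
      ((IsSymm.add (IsSymm.smul (transpose_vecMulVec _ _) _) (hA.smul _)).smul _)).neg)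
    fun w => ?_
  have h_square : w ⬝ᵥ (hessian u x * hessian u x) *ᵥ w =
      (hessian u x *ᵥ w) ⬝ᵥ (hessian u x *ᵥ w) := by
    rw [← mulVec_mulVec, dotProduct_mulVec, ← mulVec_transpose, hA]
  have h_outer : w ⬝ᵥ vecMulVec (gradVec u x) (gradVec u x) *ᵥ w = (gradVec u x ⬝ᵥ w) ^ 2 := by
    rw [vecMulVec_mulVec, op_smul_eq_smul, dotProduct_smul, dotProduct_comm w, smul_eq_mul, sq]
  simp only [star_trivial, neg_mulVec, add_mulVec, smul_mulVec, dotProduct_neg, dotProduct_add,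
    dotProduct_smul, smul_eq_mul, h_square, h_outer]
  exact neg_nonneg.2 (testFunction_conditions_of_isLocalMax hu hp hmax w).2

theorem AdmissiblePair.hasLineDerivAt_curvatureOperator {k l : ℕ}
    (h : AdmissiblePair k (gradVec u x) (hessian u x)) (hlk : l < k) (hu : ContDiffAt ℝ 3 u x)
    (v : EuclideanSpace ℝ (Fin n)) :
    HasLineDerivAt ℝ (fun y => curvatureOperator k l (gradVec u y, hessian u y))
      (fderiv ℝ (curvatureOperator k l) (gradVec u x, hessian u x)
        (hessian u x *ᵥ v.ofLp, hessianDeriv u x v)) x v :=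
  (h.hasFDerivAt hlk).comp_hasDerivAt_of_eq (0 : ℝ)
    (HasDerivAt.prodMk (hasLineDerivAt_gradVec (hu.of_le (by norm_num)) v)
      (hasLineDerivAt_hessian hu v)) (by simp)

end TestFunction

section InteriorEstimate

open scoped Matrix Topology

theorem hasLineDerivAt_source {E : Type*} [NormedAddCommGroup E] [InnerProductSpace ℝ E]
    [CompleteSpace E] {u : E → ℝ} {ψ : E × ℝ → ℝ} {x : E} (hu : DifferentiableAt ℝ u x)
    (hψ : DifferentiableAt ℝ ψ (x, u x)) (v : E) :
    HasLineDerivAt ℝ (fun y => ψ (y, u y))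
      (inner ℝ (gradient (fun y => ψ (y, u x)) x) v +
        inner ℝ (gradient u x) v * deriv (fun t : ℝ => ψ (x, t)) (u x)) x v := by
  have h_space : HasFDerivAt (fun y => ψ (y, u x)) _ x :=
    hψ.hasFDerivAt.comp x (hasFDerivAt_prodMk_left x (u x))
  have h_value : HasDerivAt (fun t : ℝ => ψ (x, t)) (fderiv ℝ ψ (x, u x) (0, 1)) (u x) :=
    hψ.hasFDerivAt.comp_hasDerivAt (u x) ((hasDerivAt_const _ x).prodMk (hasDerivAt_id _))
  have h_line : HasLineDerivAt ℝ (fun y => ψ (y, u y)) _ x v :=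
    (hψ.hasFDerivAt.comp x ((hasFDerivAt_id x).prodMk hu.hasFDerivAt)).hasLineDerivAt v
  refine h_line.congr_deriv ?_
  rw [inner_gradient_left, inner_gradient_left, h_space.fderiv, h_value.deriv, ← smul_eq_mul,
    ← map_smul]
  simp [← map_add]

variable {n : ℕ} {u : EuclideanSpace ℝ (Fin n) → ℝ} {x : EuclideanSpace ℝ (Fin n)} {k l : ℕ}

theorem not_isLocalMax_testFunction (hlk : l < k) (hu : ContDiffAt ℝ 3 u x)
    (hadm : AdmissiblePair k (gradVec u x) (hessian u x))
    {ψ : EuclideanSpace ℝ (Fin n) × ℝ → ℝ} (hψ : DifferentiableAt ℝ ψ (x, u x))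
    (heq : ∀ᶠ y in 𝓝 x, curvatureOperator k l (gradVec u y, hessian u y) = ψ (y, u y))
    {K c B : ℝ} (hK : ‖gradient (fun y => ψ (y, u x)) x‖ ≤ K)
    (hz : 0 ≤ deriv (fun t : ℝ => ψ (x, t)) (u x)) (hc : c ≤ ψ (x, u x)) (hc0 : 0 < c)
    (hB : 0 ≤ B) (hBc : K < B * c) : ¬ IsLocalMax (testFunction B u) x := by
  intro hmax
  have h_critical := hessian_mulVec_gradVec_of_isLocalMax hu hadm.lt_one hmax
  have h_norm : ‖gradient u x‖ ≤ 1 := by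
    have := hadm.lt_one
    rw [gradVec_dotProduct_self] at this
    exact ((sq_lt_one_iff₀ (norm_nonneg _)).1 this).le
  have h_operator : fderiv ℝ (curvatureOperator k l) (gradVec u x, hessian u x)
      ((-(B * (1 - gradVec u x ⬝ᵥ gradVec u x))) • gradVec u x,
        hessianDeriv u x (gradient u x)) ≤ -(B * (((k - l : ℕ) : ℝ) * ψ (x, u x))) := by
    rw [← heq.self_of_nhds]
    exact hadm.fderiv_le hlk h_critical (posSemidef_of_isLocalMax_testFunction hu hadm.lt_one hmax)
  have h_derivative := ((hadm.hasLineDerivAt_curvatureOperator hlk hu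
    (gradient u x)).congr_of_eventuallyEq (heq.mono fun _ h => h.symm)).unique
      (hasLineDerivAt_source (hu.differentiableAt (by norm_num)) hψ (gradient u x))
  rw [← gradVec, h_critical] at h_derivative
  have h_source : -K ≤ inner ℝ (gradient (fun y => ψ (y, u x)) x) (gradient u x) := by
    have h_inner : ‖gradient (fun y => ψ (y, u x)) x‖ * ‖gradient u x‖ ≤ K * 1 :=
      mul_le_mul hK h_norm (norm_nonneg _) ((norm_nonneg _).trans hK)
    linarith [neg_le_of_abs_le (abs_real_inner_le_norm (gradient (fun y => ψ (y, u x)) x)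
      (gradient u x))]
  have h_monotone : 0 ≤ inner ℝ (gradient u x) (gradient u x) *
      deriv (fun t : ℝ => ψ (x, t)) (u x) := mul_nonneg real_inner_self_nonneg hz
  have h_degree : (1 : ℝ) ≤ ((k - l : ℕ) : ℝ) := by exact_mod_cast Nat.sub_pos_of_lt hlk
  have h_lower : B * c ≤ B * (((k - l : ℕ) : ℝ) * ψ (x, u x)) :=
    mul_le_mul_of_nonneg_left
      (hc.trans (le_mul_of_one_le_left (hc0.le.trans hc) h_degree)) hB
  linarith

end InteriorEstimate

section GlobalEstimate

open Matrix
open scoped Topology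

variable {n : ℕ} {Ω : Set (EuclideanSpace ℝ (Fin n))} {u : EuclideanSpace ℝ (Fin n) → ℝ}
  {x : EuclideanSpace ℝ (Fin n)}

theorem IsC1UpToBoundary.continuousOn_gradBar (hu : IsC1UpToBoundary Ω u) :
    ContinuousOn (gradBar Ω u) (closure Ω) :=
  continuousOn_extendFrom subset_rfl hu.exists_limit

theorem IsC1UpToBoundary.gradBar_eq_gradient (hΩ : IsOpen Ω) (hu : IsC1UpToBoundary Ω u)
    (hx : x ∈ Ω) : gradBar Ω u x = gradient u x :=
  extendFrom_extends ((InnerProductSpace.toDual ℝ _).symm.continuous.comp_continuousOn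
    (hu.contDiffOn.continuousOn_fderiv_of_isOpen hΩ le_rfl)) x hx

theorem IsSpacelike.norm_gradBar_lt_one (hu : IsSpacelike Ω u) (hx : x ∈ closure Ω) :
    ‖gradBar Ω u x‖ < 1 := by
  obtain ⟨s, hs, h_le⟩ := hu
  exact (h_le x hx).trans_lt hs

theorem IsSpacelike.one_sub_norm_gradBar_sq_pos (hu : IsSpacelike Ω u) (hx : x ∈ closure Ω) :
    0 < 1 - ‖gradBar Ω u x‖ ^ 2 :=
  sub_pos.2 ((sq_lt_one_iff₀ (norm_nonneg _)).2 (hu.norm_gradBar_lt_one hx))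

theorem IsAdmissible.gradVec_dotProduct_self_lt_one {k : ℕ} (hΩ : IsOpen Ω)
    (hu : IsAdmissible k Ω u) (hx : x ∈ Ω) : gradVec u x ⬝ᵥ gradVec u x < 1 := by
  rw [gradVec_dotProduct_self, ← hu.isC1.gradBar_eq_gradient hΩ hx]
  exact sub_pos.1 (hu.spacelike.one_sub_norm_gradBar_sq_pos (subset_closure hx))

theorem IsAdmissible.contDiffAt {k : ℕ} (hΩ : IsOpen Ω) (hu : IsAdmissible k Ω u)
    (hx : x ∈ Ω) : ContDiffAt ℝ 2 u x :=
  hu.contDiffOn.contDiffAt (hΩ.mem_nhds hx)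

theorem IsAdmissible.admissiblePair {k : ℕ} (hΩ : IsOpen Ω) (hu : IsAdmissible k Ω u)
    (hx : x ∈ Ω) : AdmissiblePair k (gradVec u x) (hessian u x) :=
  admissiblePair_of_principalCurvatures_mem (hu.gradVec_dotProduct_self_lt_one hΩ hx)
    (isSymm_hessian (hu.contDiffAt hΩ hx)) (hu.convex x hx)

theorem IsAdmissible.quotientCurvature_eq {k : ℕ} (l : ℕ) (hΩ : IsOpen Ω)
    (hu : IsAdmissible k Ω u) (hx : x ∈ Ω) :
    quotientCurvature k l u x = curvatureOperator k l (gradVec u x, hessian u x) :=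
  quotientCurvature_eq_curvatureOperator k l (hu.gradVec_dotProduct_self_lt_one hΩ hx)
    (isSymm_hessian (hu.contDiffAt hΩ hx))

theorem IsMonotoneSource.differentiableAt {ψ : EuclideanSpace ℝ (Fin n) × ℝ → ℝ} (hΩ : IsOpen Ω)
    (hψ : IsMonotoneSource Ω ψ) (hx : x ∈ Ω) (z : ℝ) : DifferentiableAt ℝ ψ (x, z) :=
  (hψ.smooth.contDiffAt (Filter.mem_of_superset ((hΩ.prod isOpen_univ).mem_nhds ⟨hx, trivial⟩)
    (Set.prod_mono subset_closure subset_rfl))).differentiableAt (by simp)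

theorem wTilde_nonneg : 0 ≤ wTilde Ω u x := one_div_nonneg.2 (Real.sqrt_nonneg _)

theorem IsSpacelike.wTilde_pos (hu : IsSpacelike Ω u) (hx : x ∈ closure Ω) : 0 < wTilde Ω u x :=
  one_div_pos.2 (Real.sqrt_pos.2 (hu.one_sub_norm_gradBar_sq_pos hx))

theorem IsSpacelike.continuousOn_wTilde (hu : IsSpacelike Ω u) (hu₁ : IsC1UpToBoundary Ω u) :
    ContinuousOn (wTilde Ω u) (closure Ω) :=
  continuousOn_const.div (continuousOn_const.sub (hu₁.continuousOn_gradBar.norm.pow 2)).sqrt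
    fun _ hx => (Real.sqrt_pos.2 (hu.one_sub_norm_gradBar_sq_pos hx)).ne'

theorem IsC1UpToBoundary.wTilde_eq_lorentzFactor (hΩ : IsOpen Ω) (hu : IsC1UpToBoundary Ω u)
    (hx : x ∈ Ω) : wTilde Ω u x = lorentzFactor (gradVec u x) := by
  rw [wTilde, lorentzFactor, gradVec_dotProduct_self, hu.gradBar_eq_gradient hΩ hx]

theorem wTilde_le_of_norm_gradBar_le {s : ℝ} (hs : s < 1) (h : ‖gradBar Ω u x‖ ≤ s) :
    wTilde Ω u x ≤ 1 / √(1 - s ^ 2) := by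
  have h_pos : 0 < 1 - s ^ 2 := sub_pos.2 ((sq_lt_one_iff₀ ((norm_nonneg _).trans h)).2 hs)
  rw [wTilde]
  gcongr

theorem exists_norm_gradBar_le_of_wTilde_le (W : ℝ) : ∃ θ : ℝ, 0 < θ ∧ θ < 1 ∧
    ∀ (Ω : Set (EuclideanSpace ℝ (Fin n))) (u : EuclideanSpace ℝ (Fin n) → ℝ)
      (x : EuclideanSpace ℝ (Fin n)), IsSpacelike Ω u → x ∈ closure Ω → wTilde Ω u x ≤ W →
      ‖gradBar Ω u x‖ ≤ 1 - θ := by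
  refine ⟨1 / (2 * (W ^ 2 + 1)), by positivity, ?_, fun Ω u x hu hx hW => ?_⟩
  · rw [div_lt_one (by positivity)]
    linarith [sq_nonneg W]
  · have h_pos := hu.one_sub_norm_gradBar_sq_pos hx
    have h_lt := hu.norm_gradBar_lt_one hx
    rw [wTilde, div_le_iff₀ (Real.sqrt_pos.2 h_pos)] at hW
    have h_sq : 1 ≤ W ^ 2 * (1 - ‖gradBar Ω u x‖ ^ 2) := by
      rw [← Real.sq_sqrt h_pos.le, ← mul_pow]
      exact one_le_pow₀ hW
    have h_factor : 1 - ‖gradBar Ω u x‖ ^ 2 ≤ 2 * (1 - ‖gradBar Ω u x‖) := by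
      nlinarith [sq_nonneg (1 - ‖gradBar Ω u x‖)]
    rw [le_sub_comm, div_le_iff₀ (by positivity)]
    nlinarith [mul_le_mul_of_nonneg_left h_factor (sq_nonneg W)]

variable {k l : ℕ} {ψ : EuclideanSpace ℝ (Fin n) × ℝ → ℝ} {K c M B : ℝ}

theorem IsAdmissibleSolution.not_isLocalMax_testFunction (hlk : l < k) (hΩ : IsOpen Ω)
    (hψ : IsMonotoneSource Ω ψ) (hu₃ : ContDiffOn ℝ 3 u Ω) (hu : IsAdmissibleSolution k l Ω ψ u)
    (hbd : HasBounds K c M Ω ψ u) (hc : 0 < c) (hB : 0 ≤ B) (hBc : K < B * c) (hx : x ∈ Ω) :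
    ¬ IsLocalMax (testFunction B u) x := by
  have hM : |u x| ≤ M := hbd.abs_le x (subset_closure hx)
  refine MinkowskiGraph.not_isLocalMax_testFunction hlk (hu₃.contDiffAt (hΩ.mem_nhds hx))
    (hu.admissible.admissiblePair hΩ hx) (hψ.differentiableAt hΩ hx _) ?_
    (hbd.grad_le x hx _ hM) (hψ.deriv_nonneg x hx _) (hbd.le_source x hx _ hM) hc hB hBc
  filter_upwards [hΩ.mem_nhds hx] with y hy
  rw [← hu.admissible.quotientCurvature_eq l hΩ hy, hu.equation y hy]

theorem exists_mem_frontier_wTilde_mul_exp_le (hlk : l < k) (hΩ : IsOpen Ω)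
    (hb : Bornology.IsBounded Ω) (hψ : IsMonotoneSource Ω ψ) (hu₃ : ContDiffOn ℝ 3 u Ω)
    (hu : IsAdmissibleSolution k l Ω ψ u) (hbd : HasBounds K c M Ω ψ u) (hc : 0 < c)
    (hB : 0 ≤ B) (hBc : K < B * c) (hx : x ∈ closure Ω) :
    ∃ y ∈ frontier Ω, wTilde Ω u x * Real.exp (B * u x) ≤ wTilde Ω u y := by
  have hs := hu.admissible.spacelike
  have hu₁ := hu.admissible.isC1
  have h_cont : ContinuousOn (fun z => Real.log (wTilde Ω u z) + B * u z) (closure Ω) :=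
    ((hs.continuousOn_wTilde hu₁).log fun z hz => (hs.wTilde_pos hz).ne').add
      (continuousOn_const.mul hu₁.continuousOn)
  obtain ⟨y, hy, hmax⟩ := hb.isCompact_closure.exists_isMaxOn ⟨x, hx⟩ h_cont
  have h_exp : ∀ z ∈ closure Ω, wTilde Ω u z * Real.exp (B * u z) =
      Real.exp (Real.log (wTilde Ω u z) + B * u z) := fun z hz => by
    rw [Real.exp_add, Real.exp_log (hs.wTilde_pos hz)]
  rcases (closure_eq_self_union_frontier Ω).subset hy with hyΩ | hyf
  · refine absurd ?_ (hu.not_isLocalMax_testFunction hlk hΩ hψ hu₃ hbd hc hB hBc hyΩ)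
    refine ((hmax.on_subset subset_closure).isLocalMax (hΩ.mem_nhds hyΩ)).congr ?_
    filter_upwards [hΩ.mem_nhds hyΩ] with z hz
    rw [testFunction, hu₁.wTilde_eq_lorentzFactor hΩ hz]
  · refine ⟨y, hyf, ?_⟩
    calc wTilde Ω u x * Real.exp (B * u x) ≤ wTilde Ω u y * Real.exp (B * u y) := by
          rw [h_exp x hx, h_exp y hy]
          exact Real.exp_le_exp.2 (hmax hx)
      _ = wTilde Ω u y := by rw [hu.boundary y hyf, mul_zero, Real.exp_zero, mul_one]

theorem gradient_estimate (hlk : l < k) (K c M : ℝ) (hc : 0 < c) :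
    ∃ C : ℝ, 0 < C ∧
      ∀ (Ω : Set (EuclideanSpace ℝ (Fin n))) (ψ : EuclideanSpace ℝ (Fin n) × ℝ → ℝ)
        (u : EuclideanSpace ℝ (Fin n) → ℝ),
        IsOpen Ω → Bornology.IsBounded Ω → IsMonotoneSource Ω ψ →
        ContDiffOn ℝ 3 u Ω → IsAdmissibleSolution k l Ω ψ u → HasBounds K c M Ω ψ u →
        ∀ x ∈ closure Ω, wTilde Ω u x ≤ C * (1 + sSup (wTilde Ω u '' frontier Ω)) := by
  obtain ⟨B, hB, hBc⟩ : ∃ B : ℝ, 0 ≤ B ∧ K < B * c :=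
    ⟨(|K| + 1) / c, by positivity, by
      rw [div_mul_cancel₀ _ hc.ne']
      linarith [le_abs_self K]⟩
  refine ⟨Real.exp (B * M), Real.exp_pos _, fun Ω ψ u hΩ hb hψ hu₃ hu hbd x hx => ?_⟩
  obtain ⟨y, hy, h_le⟩ :=
    exists_mem_frontier_wTilde_mul_exp_le hlk hΩ hb hψ hu₃ hu hbd hc hB hBc hx
  obtain ⟨s, hs, h_norm⟩ := hu.admissible.spacelike
  have h_bdd : BddAbove (wTilde Ω u '' frontier Ω) := by
    refine ⟨1 / √(1 - s ^ 2), ?_⟩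
    rintro _ ⟨z, hz, rfl⟩
    exact wTilde_le_of_norm_gradBar_le hs (h_norm z (frontier_subset_closure hz))
  have h_sup : wTilde Ω u y ≤ sSup (wTilde Ω u '' frontier Ω) := le_csSup h_bdd ⟨y, hy, rfl⟩
  have h_exp : 1 ≤ Real.exp (B * M) * Real.exp (B * u x) := by
    rw [← Real.exp_add, Real.one_le_exp_iff, ← mul_add]
    exact mul_nonneg hB (by linarith [(abs_le.1 (hbd.abs_le x hx)).1])
  calc wTilde Ω u x ≤ (Real.exp (B * M) * Real.exp (B * u x)) * wTilde Ω u x :=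
        le_mul_of_one_le_left wTilde_nonneg h_exp
    _ = Real.exp (B * M) * (wTilde Ω u x * Real.exp (B * u x)) := by ring
    _ ≤ Real.exp (B * M) * (1 + sSup (wTilde Ω u '' frontier Ω)) := by gcongr; linarith

theorem spacelike_estimate (hlk : l < k) (K c M θ : ℝ) (hc : 0 < c) (hθ : 0 < θ) :
    ∃ θ₀ : ℝ, 0 < θ₀ ∧ θ₀ < 1 ∧
      ∀ (Ω : Set (EuclideanSpace ℝ (Fin n))) (ψ : EuclideanSpace ℝ (Fin n) × ℝ → ℝ)
        (u : EuclideanSpace ℝ (Fin n) → ℝ),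
        IsOpen Ω → Bornology.IsBounded Ω → IsMonotoneSource Ω ψ →
        ContDiffOn ℝ 3 u Ω → IsAdmissibleSolution k l Ω ψ u → HasBounds K c M Ω ψ u →
        (∀ x ∈ frontier Ω, ‖gradBar Ω u x‖ ≤ 1 - θ) →
        ∀ x ∈ closure Ω, ‖gradBar Ω u x‖ ≤ 1 - θ₀ := by
  obtain ⟨C, hC, h_estimate⟩ := gradient_estimate (n := n) hlk K c M hc
  obtain ⟨θ₀, hθ₀, hθ₀', h_norm⟩ :=
    exists_norm_gradBar_le_of_wTilde_le (n := n) (C * (1 + 1 / √(1 - (1 - θ) ^ 2)))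
  refine ⟨θ₀, hθ₀, hθ₀', fun Ω ψ u hΩ hb hψ hu₃ hu hbd h_boundary x hx => ?_⟩
  refine h_norm Ω u x hu.admissible.spacelike hx
    ((h_estimate Ω ψ u hΩ hb hψ hu₃ hu hbd x hx).trans ?_)
  gcongr
  refine Real.sSup_le ?_ (by positivity)
  rintro _ ⟨z, hz, rfl⟩
  exact wTilde_le_of_norm_gradBar_le (by linarith) (h_boundary z hz)

end GlobalEstimate

/-! ### The comparison principle -/

section StrictIncrease

open Matrix
open scoped Matrix.Norms.Operator Topology

theorem eventually_lt_add_smul {E : Type*} [NormedAddCommGroup E] [NormedSpace ℝ E] {f : E → ℝ}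
    {f' : E →L[ℝ] ℝ} {z d : E} (hf : HasStrictFDerivAt f f' z) (hd : 0 < f' d) :
    ∀ᶠ w : E × E × ℝ in 𝓝 (z, d, 0), 0 < w.2.2 → f w.1 < f (w.1 + w.2.2 • w.2.1) := by
  have h_pair : ContinuousAt (fun w : E × E × ℝ => (w.1 + w.2.2 • w.2.1, w.1)) (z, d, 0) := by
    fun_prop
  have h_slope : ∀ᶠ w : E × E × ℝ in 𝓝 (z, d, 0), f' d / 2 < f' w.2.1 := by
    have h_cont : ContinuousAt (fun w : E × E × ℝ => f' w.2.1) (z, d, 0) := by fun_prop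
    exact h_cont.eventually (lt_mem_nhds (half_lt_self hd))
  have h_norm : ∀ᶠ w : E × E × ℝ in 𝓝 (z, d, 0), ‖w.2.1‖ < ‖d‖ + 1 := by
    have h_cont : ContinuousAt (fun w : E × E × ℝ => ‖w.2.1‖) (z, d, 0) := by fun_prop
    exact h_cont.eventually (gt_mem_nhds (lt_add_one _))
  have h_error : ∀ᶠ w : E × E × ℝ in 𝓝 (z, d, 0),
      ‖f (w.1 + w.2.2 • w.2.1) - f w.1 - f' (w.2.2 • w.2.1)‖ ≤
        f' d / (2 * (‖d‖ + 1)) * ‖w.2.2 • w.2.1‖ := by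
    have h_small := hf.isLittleO.def (c := f' d / (2 * (‖d‖ + 1))) (by positivity)
    have h_pulled := h_pair.eventually (by simpa only [zero_smul, add_zero] using h_small)
    simpa only [add_sub_cancel_left] using h_pulled
  filter_upwards [h_slope, h_norm, h_error] with w hw_slope hw_norm hw_error hw_pos
  have h_bound : f' d / (2 * (‖d‖ + 1)) * ‖w.2.1‖ ≤ f' d / 2 := by
    calc f' d / (2 * (‖d‖ + 1)) * ‖w.2.1‖ ≤ f' d / (2 * (‖d‖ + 1)) * (‖d‖ + 1) := by gcongr
      _ = f' d / 2 := by field_simp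
  rw [map_smul, norm_smul, Real.norm_of_nonneg hw_pos.le, smul_eq_mul] at hw_error
  have h_lower := (abs_le.1 hw_error).1
  nlinarith [mul_lt_mul_of_pos_left (h_bound.trans_lt hw_slope) hw_pos]

variable {ι : Type*} [Fintype ι] [DecidableEq ι] {k l : ℕ} {p : ι → ℝ} {A S : Matrix ι ι ℝ}

/-- Strict ellipticity is stable: an increase `s S` of the Hessian outweighs the change `s r e` of
the gradient once `r` and `s` are small. -/
theorem AdmissiblePair.eventually_curvatureOperator_lt (hlk : l < k) (h : AdmissiblePair k p A)
    (e : ι → ℝ) (hS : S.PosSemidef) (hS0 : S ≠ 0) :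
    ∀ᶠ w : (ℝ × ℝ) × ((ι → ℝ) × Matrix ι ι ℝ) in 𝓝 ((0, 0), (p, A)),
      0 < w.1.2 → w.2.2.IsSymm →
        AdmissiblePair k (w.2.1 + w.1.2 • w.1.1 • e) (w.2.2 + w.1.2 • S) ∧
        curvatureOperator k l w.2 <
          curvatureOperator k l (w.2.1 + w.1.2 • w.1.1 • e, w.2.2 + w.1.2 • S) := by
  have h_admissible : ∀ᶠ w : (ℝ × ℝ) × ((ι → ℝ) × Matrix ι ι ℝ) in 𝓝 ((0, 0), (p, A)),
      (w.2.2 + w.1.2 • S).IsSymm →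
        AdmissiblePair k (w.2.1 + w.1.2 • w.1.1 • e) (w.2.2 + w.1.2 • S) := by
    have h_cont : ContinuousAt (fun w : (ℝ × ℝ) × ((ι → ℝ) × Matrix ι ι ℝ) =>
        (w.2.1 + w.1.2 • w.1.1 • e, w.2.2 + w.1.2 • S)) ((0, 0), (p, A)) := by fun_prop
    exact h_cont.eventually (by simpa using h.eventually)
  have h_increase : ∀ᶠ w : (ℝ × ℝ) × ((ι → ℝ) × Matrix ι ι ℝ) in 𝓝 ((0, 0), (p, A)),
      0 < w.1.2 → curvatureOperator k l w.2 <
        curvatureOperator k l (w.2 + w.1.2 • (w.1.1 • e, S)) := by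
    have h_lim : Filter.Tendsto (fun w : (ℝ × ℝ) × ((ι → ℝ) × Matrix ι ι ℝ) =>
        (w.2, (w.1.1 • e, S), w.1.2)) (𝓝 ((0, 0), (p, A))) (𝓝 ((p, A), (0, S), 0)) :=
      Continuous.tendsto' (by fun_prop) _ _ (by rw [zero_smul])
    have h_lt := eventually_lt_add_smul ((h.contDiffAt hlk).hasStrictFDerivAt one_ne_zero)
      (h.fderiv_pos hlk hS hS0)
    exact h_lim.eventually h_lt
  filter_upwards [h_admissible, h_increase] with w hw_admissible hw_lt hw_pos hw_symm
  exact ⟨hw_admissible (hw_symm.add ((isHermitian_iff_isSymm.1 hS.isHermitian).smul _)),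
    hw_lt hw_pos⟩

end StrictIncrease

section Comparison

open Matrix
open scoped Matrix.Norms.Operator Topology

variable {n : ℕ} {Ω : Set (EuclideanSpace ℝ (Fin n))} {u v : EuclideanSpace ℝ (Fin n) → ℝ}
  {x : EuclideanSpace ℝ (Fin n)}

theorem gradVec_add (hu : DifferentiableAt ℝ u x) (hv : DifferentiableAt ℝ v x) :
    gradVec (u + v) x = gradVec u x + gradVec v x := by
  ext i
  rw [gradVec_apply, fderiv_add hu hv, _root_.add_apply, Pi.add_apply, gradVec_apply,
    gradVec_apply]

theorem gradVec_neg : gradVec (-u) x = -gradVec u x := by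
  ext i
  rw [gradVec_apply, fderiv_neg, _root_.neg_apply, Pi.neg_apply, gradVec_apply]

theorem hessian_add (hu : ContDiffAt ℝ 2 u x) (hv : ContDiffAt ℝ 2 v x) :
    hessian (u + v) x = hessian u x + hessian v x := by
  have h_first : fderiv ℝ (u + v) =ᶠ[𝓝 x] fderiv ℝ u + fderiv ℝ v := by
    filter_upwards [hu.eventually (by simp), hv.eventually (by simp)] with y hy_u hy_v
    exact fderiv_add (hy_u.differentiableAt two_ne_zero) (hy_v.differentiableAt two_ne_zero)
  have h_diff : ∀ {w : EuclideanSpace ℝ (Fin n) → ℝ}, ContDiffAt ℝ 2 w x →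
      DifferentiableAt ℝ (fderiv ℝ w) x := fun hw =>
    (hw.fderiv_right (m := 1) le_rfl).differentiableAt one_ne_zero
  ext i j
  simp only [hessian, of_apply, Matrix.add_apply, h_first.fderiv_eq,
    fderiv_add (h_diff hu) (h_diff hv), _root_.add_apply]

theorem hessian_neg : hessian (-u) x = -hessian u x := by
  have h_first : fderiv ℝ (-u) = -fderiv ℝ u := funext fun y => fderiv_neg
  ext i j
  simp only [hessian, of_apply, Matrix.neg_apply, h_first, fderiv_neg, _root_.neg_apply]

theorem continuousAt_hessian (hu : ContDiffAt ℝ 2 u x) : ContinuousAt (hessian u) x := by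
  have h_second : ContinuousAt (fderiv ℝ (fderiv ℝ u)) x :=
    ((hu.fderiv_right (m := 1) le_rfl).fderiv_right (m := 0) le_rfl).continuousAt
  refine continuousAt_pi.2 fun i => continuousAt_pi.2 fun j => ?_
  exact (h_second.clm_apply continuousAt_const).clm_apply continuousAt_const

theorem IsAdmissible.nonpos {k : ℕ} (hk : 1 ≤ k) (hΩ : IsOpen Ω) (hb : Bornology.IsBounded Ω)
    (hu : IsAdmissible k Ω u) (h_boundary : ∀ y ∈ frontier Ω, u y = 0) (hx : x ∈ closure Ω) :
    u x ≤ 0 := by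
  obtain ⟨y, hy, hmax⟩ := hb.isCompact_closure.exists_isMaxOn ⟨x, hx⟩ hu.isC1.continuousOn
  rcases (closure_eq_self_union_frontier Ω).subset hy with hyΩ | hyf
  · have h_local : IsLocalMax u y := (hmax.on_subset subset_closure).isLocalMax (hΩ.mem_nhds hyΩ)
    obtain ⟨h_grad, h_hess⟩ := hessian_nonpos_of_isLocalMax (hu.contDiffAt hΩ hyΩ) h_local
    have h_gamma := (hu.admissiblePair hΩ hyΩ).gamma
    have := h_gamma.nontrivial hk
    have h_card : (1 : ℝ) < Fintype.card (Fin n) := by exact_mod_cast Fintype.one_lt_card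
    have h_shape : shapeMatrix 0 (hessian u y) = hessian u y := by
      simp [shapeMatrix_apply, sqrtInvMetric, lorentzFactor]
    have h_trace : (hessian u y).trace ≤ 0 :=
      Finset.sum_nonpos fun i _ => by simpa using h_hess (Pi.single i 1)
    have h_pos := h_gamma 1 le_rfl hk
    rw [h_grad, h_shape, sigma_one, trace_complementaryMatrix] at h_pos
    exact absurd h_pos
      (mul_nonpos_of_nonneg_of_nonpos (sub_nonneg.2 h_card.le) h_trace).not_gt
  · exact (hmax hx).trans (h_boundary y hyf).le

theorem curvatureOperator_le_of_isLocalMax_sub {k l : ℕ} (hlk : l < k)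
    (hu : ContDiffAt ℝ 2 u x) (hv : ContDiffAt ℝ 2 v x)
    (h : AdmissiblePair k (gradVec v x) (hessian v x)) (hmax : IsLocalMax (v + -u) x) :
    curvatureOperator k l (gradVec v x, hessian v x) ≤
      curvatureOperator k l (gradVec u x, hessian u x) := by
  have hu_neg : ContDiffAt ℝ 2 (-u) x := hu.neg
  have h_smooth : ContDiffAt ℝ 2 (v + -u) x := hv.add hu_neg
  obtain ⟨h_grad, h_hess⟩ := hessian_nonpos_of_isLocalMax h_smooth hmax
  rw [gradVec_add (hv.differentiableAt two_ne_zero) (hu_neg.differentiableAt two_ne_zero),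
    gradVec_neg, ← sub_eq_add_neg, sub_eq_zero] at h_grad
  rw [hessian_add hv hu_neg, hessian_neg] at h_hess
  have h_diff : (hessian u x - hessian v x).PosSemidef := by
    refine PosSemidef.of_dotProduct_mulVec_nonneg
      (isHermitian_iff_isSymm.2 ((isSymm_hessian hu).sub (isSymm_hessian hv))) fun w => ?_
    have h_le := h_hess w
    rw [add_mulVec, neg_mulVec, dotProduct_add, dotProduct_neg] at h_le
    rw [star_trivial, sub_mulVec, dotProduct_sub]
    linarith
  simpa only [h_grad, add_sub_cancel] using h.le_add hlk h_diff

/-- The barrier `t r² exp(y_i / r)`: for small `r` its Hessian dominates its gradient. -/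
noncomputable def barrier (i : Fin n) (r t : ℝ) (y : EuclideanSpace ℝ (Fin n)) : ℝ :=
  t * (r ^ 2 * Real.exp (y i / r))

theorem contDiff_barrier (i : Fin n) (r t : ℝ) : ContDiff ℝ 2 (barrier i r t) := by
  unfold barrier
  fun_prop

theorem hasFDerivAt_exp_coord_div (i : Fin n) (r : ℝ) (y : EuclideanSpace ℝ (Fin n)) :
    HasFDerivAt (fun y : EuclideanSpace ℝ (Fin n) => Real.exp (y i / r))
      ((Real.exp (y i / r) / r) •
        (EuclideanSpace.proj i : EuclideanSpace ℝ (Fin n) →L[ℝ] ℝ)) y := by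
  have h_proj : HasFDerivAt (fun y : EuclideanSpace ℝ (Fin n) => y i)
      (EuclideanSpace.proj i : EuclideanSpace ℝ (Fin n) →L[ℝ] ℝ) y :=
    (EuclideanSpace.proj i : EuclideanSpace ℝ (Fin n) →L[ℝ] ℝ).hasFDerivAt
  simpa only [div_eq_mul_inv, smul_smul] using (h_proj.mul_const r⁻¹).exp

theorem fderiv_barrier (i : Fin n) {r : ℝ} (hr : r ≠ 0) (t : ℝ) (y : EuclideanSpace ℝ (Fin n)) :
    fderiv ℝ (barrier i r t) y = (t * (r * Real.exp (y i / r))) •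
      (EuclideanSpace.proj i : EuclideanSpace ℝ (Fin n) →L[ℝ] ℝ) := by
  have h := ((hasFDerivAt_exp_coord_div i r y).const_mul (r ^ 2)).const_mul t
  rw [show fderiv ℝ (barrier i r t) y = _ from h.fderiv, smul_smul, smul_smul]
  congr 1
  field_simp

theorem gradVec_barrier (i : Fin n) {r : ℝ} (hr : r ≠ 0) (t : ℝ) (y : EuclideanSpace ℝ (Fin n)) :
    gradVec (barrier i r t) y = (t * Real.exp (y i / r)) • r • Pi.single i 1 := by
  ext j
  rw [gradVec_apply, fderiv_barrier i hr]
  simp only [_root_.smul_apply, PiLp.proj_apply, PiLp.single_apply, Pi.smul_apply,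
    Pi.single_apply, smul_eq_mul, eq_comm (a := i)]
  ring

theorem hessian_barrier (i : Fin n) {r : ℝ} (hr : r ≠ 0) (t : ℝ) (y : EuclideanSpace ℝ (Fin n)) :
    hessian (barrier i r t) y =
      (t * Real.exp (y i / r)) • vecMulVec (Pi.single i 1) (Pi.single i 1) := by
  have h := (((hasFDerivAt_exp_coord_div i r y).const_mul r).const_mul t).smul_const
    (EuclideanSpace.proj i : EuclideanSpace ℝ (Fin n) →L[ℝ] ℝ)
  ext j m
  rw [hessian, of_apply, funext (fderiv_barrier i hr t), h.fderiv]
  simp only [ContinuousLinearMap.smulRight_apply, _root_.smul_apply, PiLp.proj_apply,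
    PiLp.single_apply, Matrix.smul_apply, vecMulVec_apply, Pi.single_apply, smul_eq_mul,
    eq_comm (a := i)]
  field_simp

variable {k l : ℕ} {K : Set (EuclideanSpace ℝ (Fin n))}

theorem IsAdmissible.exists_forall_curvatureOperator_lt (hlk : l < k) (hΩ : IsOpen Ω)
    (hv : IsAdmissible k Ω v) (hK : IsCompact K) (hKΩ : K ⊆ Ω) (e : Fin n → ℝ)
    {S : Matrix (Fin n) (Fin n) ℝ} (hS : S.PosSemidef) (hS0 : S ≠ 0) :
    ∃ r : ℝ, 0 < r ∧ ∃ δ : ℝ, 0 < δ ∧ ∀ y ∈ K, ∀ s : ℝ, 0 < s → s < δ →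
      AdmissiblePair k (gradVec v y + s • r • e) (hessian v y + s • S) ∧
      curvatureOperator k l (gradVec v y, hessian v y) <
        curvatureOperator k l (gradVec v y + s • r • e, hessian v y + s • S) := by
  have h_uniform : ∀ᶠ a : ℝ × ℝ in 𝓝 (0, 0), ∀ y ∈ K, 0 < a.2 → (hessian v y).IsSymm →
      AdmissiblePair k (gradVec v y + a.2 • a.1 • e) (hessian v y + a.2 • S) ∧
      curvatureOperator k l (gradVec v y, hessian v y) <
        curvatureOperator k l (gradVec v y + a.2 • a.1 • e, hessian v y + a.2 • S) := by
    refine hK.eventually_forall_of_forall_eventually fun y hy => ?_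
    have h_jet : ContinuousAt (fun b : (ℝ × ℝ) × EuclideanSpace ℝ (Fin n) =>
        (b.1, (gradVec v b.2, hessian v b.2))) ((0, 0), y) := by
      have h_diff := hv.contDiffAt hΩ (hKΩ hy)
      exact continuousAt_fst.prodMk
        (((continuousAt_gradVec (h_diff.of_le one_le_two)).comp_of_eq continuousAt_snd rfl).prodMk
          ((continuousAt_hessian h_diff).comp_of_eq continuousAt_snd rfl))
    exact h_jet.eventually
      ((hv.admissiblePair hΩ (hKΩ hy)).eventually_curvatureOperator_lt hlk e hS hS0)
  rw [nhds_prod_eq, Filter.eventually_prod_iff] at h_uniform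
  obtain ⟨P, hP, Q, hQ, h_all⟩ := h_uniform
  obtain ⟨r, hr, hPr⟩ := ((hP.filter_mono nhdsWithin_le_nhds).and
    (self_mem_nhdsWithin : ∀ᶠ r : ℝ in 𝓝[>] 0, 0 < r)).exists.imp fun _ h => h.symm
  obtain ⟨δ, hδ, hQδ⟩ := Metric.eventually_nhds_iff.1 hQ
  refine ⟨r, hr, δ, hδ, fun y hy s hs hsδ => ?_⟩
  have hQs : Q s := hQδ (by rwa [Real.dist_0_eq_abs, abs_of_pos hs])
  exact h_all hPr hQs y hy hs (isSymm_hessian (hv.contDiffAt hΩ (hKΩ hy)))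

theorem IsAdmissible.exists_strict_perturbation (hlk : l < k) (i : Fin n) (hΩ : IsOpen Ω)
    (hb : Bornology.IsBounded Ω) (hv : IsAdmissible k Ω v) (hK : IsCompact K) (hKΩ : K ⊆ Ω)
    {m : ℝ} (hm : 0 < m) :
    ∃ φ : EuclideanSpace ℝ (Fin n) → ℝ, ContDiff ℝ 2 φ ∧ (∀ y ∈ closure Ω, 0 ≤ φ y ∧ φ y ≤ m) ∧
      ∀ y ∈ K, AdmissiblePair k (gradVec (v + φ) y) (hessian (v + φ) y) ∧
        curvatureOperator k l (gradVec v y, hessian v y) <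
          curvatureOperator k l (gradVec (v + φ) y, hessian (v + φ) y) := by
  have h_psd : (vecMulVec (Pi.single i (1 : ℝ)) (Pi.single i 1)).PosSemidef := by
    simpa using posSemidef_vecMulVec_self_star (Pi.single i (1 : ℝ) : Fin n → ℝ)
  have h_ne : vecMulVec (Pi.single i (1 : ℝ)) (Pi.single i (1 : ℝ)) ≠ 0 := fun h => by
    simpa [vecMulVec_apply] using congrFun₂ h i i
  obtain ⟨r, hr, δ, hδ, h_lt⟩ :=
    hv.exists_forall_curvatureOperator_lt hlk hΩ hK hKΩ (Pi.single i 1) h_psd h_ne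
  obtain ⟨b, hb_exp⟩ := hb.isCompact_closure.bddAbove_image
    (f := fun y : EuclideanSpace ℝ (Fin n) => Real.exp (y i / r)) (by fun_prop)
  obtain ⟨t, ht, htb⟩ := exists_pos_mul_lt (lt_min hδ (div_pos hm (pow_pos hr 2))) b
  have h_scale : ∀ y ∈ closure Ω, t * Real.exp (y i / r) < min δ (m / r ^ 2) := fun y hy => by
    have h_exp : Real.exp (y i / r) ≤ b := hb_exp ⟨y, hy, rfl⟩
    nlinarith
  refine ⟨barrier i r t, contDiff_barrier i r t, fun y hy => ⟨?_, ?_⟩, fun y hy => ?_⟩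
  · unfold barrier
    positivity
  · have h_le := (h_scale y hy).le.trans (min_le_right _ _)
    rw [le_div_iff₀ (pow_pos hr 2)] at h_le
    unfold barrier
    linarith
  · have h_diff := hv.contDiffAt hΩ (hKΩ hy)
    have h_barrier := (contDiff_barrier i r t).contDiffAt (x := y)
    rw [gradVec_add (h_diff.differentiableAt two_ne_zero) (h_barrier.differentiableAt two_ne_zero),
      hessian_add h_diff h_barrier, gradVec_barrier i hr.ne', hessian_barrier i hr.ne']
    exact h_lt y hy _ (by positivity)
      ((h_scale y (subset_closure (hKΩ hy))).trans_le (min_le_left _ _))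

variable {ψ : EuclideanSpace ℝ (Fin n) × ℝ → ℝ}

theorem IsMonotoneSource.monotone (hΩ : IsOpen Ω) (hψ : IsMonotoneSource Ω ψ) (hx : x ∈ Ω) :
    Monotone fun z => ψ (x, z) :=
  monotone_of_deriv_nonneg
    (fun z => (hψ.differentiableAt hΩ hx z).comp z (by fun_prop)) (hψ.deriv_nonneg x hx)

theorem isCompact_superlevel (hb : Bornology.IsBounded Ω)
    {w : EuclideanSpace ℝ (Fin n) → ℝ} (hw : ContinuousOn w (closure Ω)) (a : ℝ) :
    IsCompact {y ∈ closure Ω | a ≤ w y} :=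
  hb.isCompact_closure.of_isClosed_subset
    (hw.preimage_isClosed_of_isClosed isClosed_closure isClosed_Ici) (Set.sep_subset _ _)

theorem superlevel_subset {w : EuclideanSpace ℝ (Fin n) → ℝ} (hw : ∀ y ∈ frontier Ω, w y = 0)
    {a : ℝ} (ha : 0 < a) : {y ∈ closure Ω | a ≤ w y} ⊆ Ω := fun y ⟨hy, hy_le⟩ =>
  ((closure_eq_self_union_frontier Ω).subset hy).resolve_right fun hyf =>
    (ha.trans_le hy_le).ne' (hw y hyf)

theorem exists_isLocalMax_add (hΩ : IsOpen Ω) (hb : Bornology.IsBounded Ω)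
    {w φ : EuclideanSpace ℝ (Fin n) → ℝ} (hw : ContinuousOn w (closure Ω))
    (hw_frontier : ∀ y ∈ frontier Ω, w y = 0) (hφ : ContinuousOn φ (closure Ω))
    (hx : x ∈ closure Ω) (hwx : 0 < w x) (hφ_le : ∀ y ∈ closure Ω, 0 ≤ φ y ∧ φ y ≤ w x / 2) :
    ∃ y ∈ {y ∈ closure Ω | w x / 2 ≤ w y}, IsLocalMax (w + φ) y := by
  obtain ⟨y, hy, hmax⟩ := hb.isCompact_closure.exists_isMaxOn ⟨x, hx⟩ (hw.add hφ)
  have h_le : w x + φ x ≤ w y + φ y := hmax hx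
  have hy_mem : y ∈ {y ∈ closure Ω | w x / 2 ≤ w y} :=
    ⟨hy, by linarith [(hφ_le x hx).1, (hφ_le y hy).2]⟩
  exact ⟨y, hy_mem, (hmax.on_subset subset_closure).isLocalMax
    (hΩ.mem_nhds (superlevel_subset hw_frontier (half_pos hwx) hy_mem))⟩

theorem subsolution_le (hlk : l < k) (hΩ : IsOpen Ω) (hb : Bornology.IsBounded Ω)
    (hψ : IsMonotoneSource Ω ψ) (hu : IsAdmissibleSolution k l Ω ψ u)
    (hv : IsAdmissibleSubsolution k l Ω ψ v) (hx : x ∈ closure Ω) : v x ≤ u x := by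
  by_contra! h_lt
  have hw : ContinuousOn (v + -u) (closure Ω) :=
    hv.admissible.isC1.continuousOn.add hu.admissible.isC1.continuousOn.neg
  have hw_frontier : ∀ y ∈ frontier Ω, (v + -u) y = 0 := fun y hy => by
    rw [Pi.add_apply, Pi.neg_apply, hv.boundary y hy, hu.boundary y hy, neg_zero, add_zero]
  have hwx : 0 < (v + -u) x := by simpa [← sub_eq_add_neg] using h_lt
  have h_subset := superlevel_subset hw_frontier (half_pos hwx)
  have hxΩ : x ∈ Ω := h_subset ⟨hx, half_le_self hwx.le⟩
  have := (hv.admissible.admissiblePair hΩ hxΩ).gamma.nontrivial (by lia)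
  obtain ⟨φ, hφ, hφ_le, h_strict⟩ := hv.admissible.exists_strict_perturbation hlk
    (Classical.arbitrary (Fin n)) hΩ hb (isCompact_superlevel hb hw _) h_subset (half_pos hwx)
  obtain ⟨y, hy, hmax⟩ := exists_isLocalMax_add hΩ hb hw hw_frontier hφ.continuous.continuousOn
    hx hwx hφ_le
  have hyΩ := h_subset hy
  have h_smooth : ContDiffAt ℝ 2 (v + φ) y :=
    (hv.admissible.contDiffAt hΩ hyΩ).add hφ.contDiffAt
  have h_le : u y ≤ v y := by
    have h_nonneg : 0 ≤ (v + -u) y := (half_pos hwx).le.trans hy.2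
    rwa [Pi.add_apply, Pi.neg_apply, ← sub_eq_add_neg, sub_nonneg] at h_nonneg
  obtain ⟨h_pair, h_increase⟩ := h_strict y hy
  refine lt_irrefl (ψ (y, u y)) ?_
  calc ψ (y, u y) ≤ ψ (y, v y) := hψ.monotone hΩ hyΩ h_le
    _ ≤ quotientCurvature k l v y := hv.inequality y hyΩ
    _ = curvatureOperator k l (gradVec v y, hessian v y) :=
        hv.admissible.quotientCurvature_eq l hΩ hyΩ
    _ < curvatureOperator k l (gradVec (v + φ) y, hessian (v + φ) y) := h_increase
    _ ≤ curvatureOperator k l (gradVec u y, hessian u y) :=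
        curvatureOperator_le_of_isLocalMax_sub hlk (hu.admissible.contDiffAt hΩ hyΩ) h_smooth
          h_pair (by rwa [add_right_comm])
    _ = quotientCurvature k l u y := (hu.admissible.quotientCurvature_eq l hΩ hyΩ).symm
    _ = ψ (y, u y) := hu.equation y hyΩ

end Comparison

/-! ### The boundary gradient estimate -/

section DefiningFunction

open scoped Topology

theorem nonpos_of_mem_frontier {X : Type*} [TopologicalSpace X] {S : Set X} {ρ : X → ℝ} {p : X}
    (hp : p ∈ frontier S) (hρ : ContinuousAt ρ p) (hSρ : ∀ᶠ x in 𝓝 p, (x ∈ S ↔ ρ x < 0)) :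
    ρ p ≤ 0 := by
  by_contra! h_pos
  have h_notMem : ∀ᶠ x in 𝓝 p, x ∉ S := by
    filter_upwards [hρ.eventually (lt_mem_nhds h_pos), hSρ] with x hx hx_iff
    exact fun hxS => hx.not_gt (hx_iff.1 hxS)
  exact mem_closure_iff_frequently.1 (frontier_subset_closure hp) h_notMem

theorem eventually_mem_of_fderiv_neg {E : Type*} [NormedAddCommGroup E] [NormedSpace ℝ E]
    {S : Set E} {ρ : E → ℝ} {p ξ : E} (hp : p ∈ frontier S) (hρ : DifferentiableAt ℝ ρ p)
    (hSρ : ∀ᶠ x in 𝓝 p, (x ∈ S ↔ ρ x < 0)) (hξ : fderiv ℝ ρ p ξ < 0) :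
    ∀ᶠ t : ℝ in 𝓝[>] 0, p + t • ξ ∈ S := by
  have hρp : ρ p ≤ 0 := nonpos_of_mem_frontier hp hρ.continuousAt hSρ
  have h_slope := (hρ.hasFDerivAt.hasLineDerivAt ξ).tendsto_slope_zero_right.eventually
    (gt_mem_nhds hξ)
  have h_iff := (eventually_line hSρ ξ).filter_mono (nhdsWithin_le_nhds (s := Set.Ioi 0))
  filter_upwards [h_slope, h_iff, self_mem_nhdsWithin] with t ht ht_iff ht_pos
  have h_decrease : ρ (p + t • ξ) - ρ p < 0 :=
    (smul_neg_iff_of_pos_left (inv_pos.2 ht_pos)).1 ht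
  exact ht_iff.2 (by linarith)

end DefiningFunction

section Boundary

open scoped Topology

variable {F : Type*} [NormedAddCommGroup F] [InnerProductSpace ℝ F] {N a b : F}

theorem exists_nonneg_smul_eq_of_inner_nonpos (hN : N ≠ 0)
    (ha : ∀ ξ, inner ℝ N ξ < 0 → inner ℝ a ξ ≤ 0) : ∃ c : ℝ, 0 ≤ c ∧ c • N = a := by
  have hNN : 0 < inner ℝ N N := real_inner_self_pos.2 hN
  have ha_closed : ∀ ξ, inner ℝ N ξ ≤ 0 → inner ℝ a ξ ≤ 0 := fun ξ hξ => by
    have h_tendsto : Filter.Tendsto (fun t : ℝ => inner ℝ a (ξ - t • N)) (𝓝[>] 0)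
        (𝓝 (inner ℝ a ξ)) := by
      have h_cont : Continuous fun t : ℝ => inner ℝ a (ξ - t • N) := by fun_prop
      simpa using (h_cont.tendsto 0).mono_left nhdsWithin_le_nhds
    refine le_of_tendsto h_tendsto ?_
    filter_upwards [self_mem_nhdsWithin] with t (ht : 0 < t)
    refine ha _ ?_
    rw [inner_sub_right, real_inner_smul_right]
    linarith [mul_pos ht hNN]
  set c := inner ℝ a N / inner ℝ N N
  have h_orth : inner ℝ N (a - c • N) = 0 := by
    rw [inner_sub_right, real_inner_smul_right, div_mul_cancel₀ _ hNN.ne', real_inner_comm,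
      sub_self]
  have h_self : inner ℝ (a - c • N) (a - c • N) = inner ℝ a (a - c • N) := by
    rw [inner_sub_left, real_inner_smul_left, h_orth, mul_zero, sub_zero]
  refine ⟨c, div_nonneg ?_ hNN.le, (sub_eq_zero.1 (inner_self_eq_zero.1
    (le_antisymm ?_ real_inner_self_nonneg))).symm⟩
  · simpa using ha_closed (-N) (by simp)
  · rw [h_self]
    exact ha_closed _ h_orth.le

theorem norm_le_norm_of_inner_le (hN : N ≠ 0) (ha : ∀ ξ, inner ℝ N ξ < 0 → inner ℝ a ξ ≤ 0)
    (hb : ∀ ξ, inner ℝ N ξ < 0 → inner ℝ b ξ ≤ inner ℝ a ξ) : ‖a‖ ≤ ‖b‖ := by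
  obtain ⟨c, hc, rfl⟩ := exists_nonneg_smul_eq_of_inner_nonpos hN ha
  have h_inner : inner ℝ (c • N) N ≤ inner ℝ b N := by
    simpa using hb (-N) (by simpa using pow_pos (norm_pos_iff.2 hN) 2)
  refine le_of_mul_le_mul_right ?_ (norm_pos_iff.2 hN)
  calc ‖c • N‖ * ‖N‖ = inner ℝ (c • N) N := by
        rw [norm_smul, Real.norm_of_nonneg hc, real_inner_smul_left,
          real_inner_self_eq_norm_mul_norm, mul_assoc]
    _ ≤ inner ℝ b N := h_inner
    _ ≤ ‖b‖ * ‖N‖ := real_inner_le_norm b N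

theorem hasDerivWithinAt_nonpos {g : ℝ → ℝ} {e : ℝ} (hg : HasDerivWithinAt g e (Set.Ici 0) 0)
    (h_le : ∀ᶠ t in 𝓝[>] (0 : ℝ), g t ≤ g 0) : e ≤ 0 := by
  refine le_of_tendsto (hasDerivWithinAt_iff_tendsto_slope' Set.self_notMem_Ioi |>.1
    hg.Ioi_of_Ici) ?_
  filter_upwards [h_le, self_mem_nhdsWithin] with t ht (ht_pos : 0 < t)
  rw [slope_def_field]
  exact div_nonpos_of_nonpos_of_nonneg (sub_nonpos.2 ht) (sub_nonneg.2 ht_pos.le)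

variable {n : ℕ} {Ω : Set (EuclideanSpace ℝ (Fin n))} {u v : EuclideanSpace ℝ (Fin n) → ℝ}
  {p ξ : EuclideanSpace ℝ (Fin n)}

theorem IsC1UpToBoundary.hasDerivWithinAt_line (hΩ : IsOpen Ω) (hu : IsC1UpToBoundary Ω u)
    (hp : p ∈ closure Ω) (hξ : ∀ᶠ t : ℝ in 𝓝[>] 0, p + t • ξ ∈ Ω) :
    HasDerivWithinAt (fun t : ℝ => u (p + t • ξ)) (inner ℝ (gradBar Ω u p) ξ) (Set.Ici 0) 0 := by
  have h_deriv : ∀ t : ℝ, p + t • ξ ∈ Ω →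
      HasDerivAt (fun t : ℝ => u (p + t • ξ)) (inner ℝ (gradient u (p + t • ξ)) ξ) t := by
    intro t ht
    have h_line : HasDerivAt (fun t : ℝ => p + t • ξ) ξ t := by
      simpa using ((hasDerivAt_id t).smul_const ξ).const_add p
    rw [inner_gradient_left]
    exact (((hu.contDiffOn.contDiffAt (hΩ.mem_nhds ht)).differentiableAt
      one_ne_zero).hasFDerivAt).comp_hasDerivAt t h_line
  have h_path : Filter.Tendsto (fun t : ℝ => p + t • ξ) (𝓝[>] 0) (𝓝[Ω] p) := by
    have h_cont : Continuous fun t : ℝ => p + t • ξ := by fun_prop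
    refine tendsto_nhdsWithin_iff.2 ⟨?_, hξ⟩
    simpa using (h_cont.tendsto 0).mono_left nhdsWithin_le_nhds
  refine hasDerivWithinAt_Ici_of_tendsto_deriv (s := {t : ℝ | p + t • ξ ∈ Ω})
    (fun t ht => (h_deriv t ht).differentiableAt.differentiableWithinAt) ?_ hξ ?_
  · have h_cont : ContinuousWithinAt u (closure Ω) (p + (0 : ℝ) • ξ) := by
      simpa using hu.continuousOn p hp
    exact h_cont.comp (f := fun t : ℝ => p + t • ξ) (by fun_prop) fun t ht => subset_closure ht
  · have h_lim : Filter.Tendsto (gradient u) (𝓝[Ω] p) (𝓝 (gradBar Ω u p)) :=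
      tendsto_extendFrom (hu.exists_limit p hp)
    refine ((h_lim.comp h_path).inner (𝕜 := ℝ) tendsto_const_nhds).congr' ?_
    filter_upwards [hξ] with t ht
    exact (h_deriv t ht).deriv.symm

theorem norm_gradBar_le_of_le {ρ : EuclideanSpace ℝ (Fin n) → ℝ} (hΩ : IsOpen Ω)
    (hp : p ∈ frontier Ω) (hρ : DifferentiableAt ℝ ρ p) (hρ_ne : fderiv ℝ ρ p ≠ 0)
    (hΩρ : ∀ᶠ x in 𝓝 p, (x ∈ Ω ↔ ρ x < 0)) (hu : IsC1UpToBoundary Ω u)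
    (hv : IsC1UpToBoundary Ω v) (hu_le : ∀ x ∈ Ω, u x ≤ u p) (hvu : ∀ x ∈ Ω, v x ≤ u x)
    (hvu_eq : v p = u p) : ‖gradBar Ω u p‖ ≤ ‖gradBar Ω v p‖ := by
  have hpc := frontier_subset_closure hp
  have h_inward : ∀ ξ, inner ℝ (gradient ρ p) ξ < 0 → ∀ᶠ t : ℝ in 𝓝[>] 0, p + t • ξ ∈ Ω :=
    fun ξ hξ => eventually_mem_of_fderiv_neg hp hρ hΩρ (by rwa [inner_gradient_left] at hξ)
  have h_normal : gradient ρ p ≠ 0 := (map_ne_zero_iff _ (LinearIsometryEquiv.injective _)).2 hρ_ne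
  refine norm_le_norm_of_inner_le h_normal (fun ξ hξ => ?_) fun ξ hξ => ?_
  · refine hasDerivWithinAt_nonpos (hu.hasDerivWithinAt_line hΩ hpc (h_inward ξ hξ)) ?_
    filter_upwards [h_inward ξ hξ] with t ht
    simpa using hu_le _ ht
  · refine sub_nonpos.1 (hasDerivWithinAt_nonpos ((hv.hasDerivWithinAt_line hΩ hpc
      (h_inward ξ hξ)).sub (hu.hasDerivWithinAt_line hΩ hpc (h_inward ξ hξ))) ?_)
    filter_upwards [h_inward ξ hξ] with t ht
    simpa [hvu_eq] using hvu _ ht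

end Boundary

/-! ### The spacelike bound from a subsolution -/

section SourceBounds

open scoped Topology

theorem bddAbove_norm_fderiv_image_inter_interior {𝕜 E F : Type*} [NontriviallyNormedField 𝕜]
    [NormedAddCommGroup E] [NormedSpace 𝕜 E] [NormedAddCommGroup F] [NormedSpace 𝕜 F]
    {f : E → F} {S K : Set E} (hf : ContDiffOn 𝕜 1 f S) (hK : IsCompact K) (hKS : K ⊆ S) :
    BddAbove ((fun y => ‖fderiv 𝕜 f y‖) '' (K ∩ interior S)) := by
  refine hK.induction_on (p := fun t => BddAbove ((fun y => ‖fderiv 𝕜 f y‖) '' (t ∩ interior S)))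
    (by simp) (fun s t hst ht => ht.mono (by gcongr)) (fun s t hs ht => ?_) fun y hy => ?_
  · rw [Set.union_inter_distrib_right, Set.image_union]
    exact hs.union ht
  · have hyS := hKS hy
    obtain ⟨U, hU, -, -, f', hf', hc⟩ :=
      (contDiffWithinAt_succ_iff_hasFDerivWithinAt' (n := 0) (by simp)).1 (hf y hyS)
    rw [Set.insert_eq_of_mem hyS] at hU
    have h_lt := hc.continuousWithinAt.norm.eventually (gt_mem_nhds (lt_add_one ‖f' y‖))
    refine ⟨{w | w ∈ U ∧ ‖f' w‖ < ‖f' y‖ + 1}, nhdsWithin_mono y hKS (Filter.inter_mem hU h_lt),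
      ‖f' y‖ + 1, ?_⟩
    rintro _ ⟨w, ⟨⟨hwU, hw_lt⟩, hwS⟩, rfl⟩
    simpa only [((hf' w hwU).hasFDerivAt (mem_interior_iff_mem_nhds.1 hwS)).fderiv] using hw_lt.le

variable {n : ℕ} {Ω : Set (EuclideanSpace ℝ (Fin n))} {ψ : EuclideanSpace ℝ (Fin n) × ℝ → ℝ}

theorem norm_gradient_slice_le {x : EuclideanSpace ℝ (Fin n)} {z : ℝ}
    (hψ : DifferentiableAt ℝ ψ (x, z)) :
    ‖gradient (fun y => ψ (y, z)) x‖ ≤ ‖fderiv ℝ ψ (x, z)‖ := by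
  have h_slice : HasFDerivAt (fun y => ψ (y, z))
      ((fderiv ℝ ψ (x, z)).comp (ContinuousLinearMap.inl ℝ (EuclideanSpace ℝ (Fin n)) ℝ)) x :=
    hψ.hasFDerivAt.comp x (hasFDerivAt_prodMk_left x z)
  rw [gradient, LinearIsometryEquiv.norm_map, h_slice.fderiv]
  exact (ContinuousLinearMap.opNorm_comp_le _ _).trans
    (mul_le_of_le_one_right (norm_nonneg _) (ContinuousLinearMap.norm_inl_le_one _ _ _))

theorem isCompact_closure_prod_Icc (hb : Bornology.IsBounded Ω) (M : ℝ) :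
    IsCompact (closure Ω ×ˢ Set.Icc (-M) M) :=
  hb.isCompact_closure.prod isCompact_Icc

theorem IsMonotoneSource.exists_pos_le (hb : Bornology.IsBounded Ω)
    (hψ : IsMonotoneSource Ω ψ) (M : ℝ) :
    ∃ c : ℝ, 0 < c ∧ ∀ x ∈ Ω, ∀ z : ℝ, |z| ≤ M → c ≤ ψ (x, z) := by
  obtain ⟨c, hc, h_le⟩ := (isCompact_closure_prod_Icc hb M).exists_forall_le'
    (hψ.smooth.continuousOn.mono (by gcongr; exact Set.subset_univ _))
    fun y hy => hψ.pos y.1 hy.1 y.2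
  exact ⟨c, hc, fun x hx z hz => h_le (x, z) ⟨subset_closure hx, abs_le.1 hz⟩⟩

theorem IsMonotoneSource.exists_norm_gradient_le (hΩ : IsOpen Ω) (hb : Bornology.IsBounded Ω)
    (hψ : IsMonotoneSource Ω ψ) (M : ℝ) :
    ∃ K : ℝ, ∀ x ∈ Ω, ∀ z : ℝ, |z| ≤ M → ‖gradient (fun y => ψ (y, z)) x‖ ≤ K := by
  obtain ⟨K, hK⟩ := bddAbove_norm_fderiv_image_inter_interior (hψ.smooth.of_le (by simp))
    (isCompact_closure_prod_Icc hb M) (by gcongr; exact Set.subset_univ _)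
  refine ⟨K, fun x hx z hz => (norm_gradient_slice_le (hψ.differentiableAt hΩ hx z)).trans
    (hK ⟨(x, z), ⟨⟨subset_closure hx, abs_le.1 hz⟩, ?_⟩, rfl⟩)⟩
  exact interior_mono (Set.prod_mono subset_closure subset_rfl)
    ((hΩ.prod isOpen_univ).interior_eq.symm.subset ⟨hx, trivial⟩)

theorem spacelike_estimate_of_subsolution {k l : ℕ} {v : EuclideanSpace ℝ (Fin n) → ℝ}
    (hlk : l < k) (hΩ : IsOpen Ω) (hb : Bornology.IsBounded Ω) (hs : HasSmoothBoundary Ω)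
    (hψ : IsMonotoneSource Ω ψ) (hv : IsAdmissibleSubsolution k l Ω ψ v) :
    ∃ θ₀ : ℝ, 0 < θ₀ ∧ θ₀ < 1 ∧
      ∀ u : EuclideanSpace ℝ (Fin n) → ℝ, ContDiffOn ℝ 3 u Ω → IsAdmissibleSolution k l Ω ψ u →
        ∀ x ∈ closure Ω, ‖gradBar Ω u x‖ ≤ 1 - θ₀ := by
  obtain ⟨M, hM⟩ :=
    hb.isCompact_closure.exists_bound_of_continuousOn hv.admissible.isC1.continuousOn
  obtain ⟨c, hc, h_source⟩ := hψ.exists_pos_le hb M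
  obtain ⟨K, hK⟩ := hψ.exists_norm_gradient_le hΩ hb M
  obtain ⟨s, hs_lt, h_spacelike⟩ := hv.admissible.spacelike
  obtain ⟨θ₀, hθ₀, hθ₀', h_estimate⟩ := spacelike_estimate (n := n) hlk K c M (1 - s) hc
    (sub_pos.2 hs_lt)
  refine ⟨θ₀, hθ₀, hθ₀', fun u hu₃ hu => ?_⟩
  have h_nonpos : ∀ x ∈ closure Ω, u x ≤ 0 := fun x hx =>
    hu.admissible.nonpos (by lia) hΩ hb hu.boundary hx
  have h_le : ∀ x ∈ closure Ω, v x ≤ u x := fun x hx => subsolution_le hlk hΩ hb hψ hu hv hx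
  refine h_estimate Ω ψ u hΩ hb hψ hu₃ hu ⟨fun x hx => ?_, hK, h_source⟩ fun p hp => ?_
  · rw [abs_of_nonpos (h_nonpos x hx)]
    exact (neg_le_neg (h_le x hx)).trans ((neg_le_abs _).trans (hM x hx))
  · obtain ⟨ρ, hρ, hρ_ne, hΩρ⟩ := hs p hp
    calc ‖gradBar Ω u p‖ ≤ ‖gradBar Ω v p‖ :=
          norm_gradBar_le_of_le hΩ hp (hρ.contDiffAt.differentiableAt (by simp)) hρ_ne hΩρ
            hu.admissible.isC1 hv.admissible.isC1
            (fun y hy => (h_nonpos y (subset_closure hy)).trans_eq (hu.boundary p hp).symm)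
            (fun y hy => h_le y (subset_closure hy))
            ((hv.boundary p hp).trans (hu.boundary p hp).symm)
      _ ≤ s := h_spacelike p (frontier_subset_closure hp)
      _ = 1 - (1 - s) := (sub_sub_cancel 1 s).symm

end SourceBounds

end MinkowskiGraph

theorem theorem3p1_general {n k l : ℕ} (hlk : l < k) :
    (∀ K c M : ℝ, 0 < c → ∃ C : ℝ, 0 < C ∧
      ∀ (Ω : Set (EuclideanSpace ℝ (Fin n))) (ψ : EuclideanSpace ℝ (Fin n) × ℝ → ℝ)
        (u : EuclideanSpace ℝ (Fin n) → ℝ),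
        IsOpen Ω → Bornology.IsBounded Ω → MinkowskiGraph.IsMonotoneSource Ω ψ →
        ContDiffOn ℝ 3 u Ω → MinkowskiGraph.IsAdmissibleSolution k l Ω ψ u →
        MinkowskiGraph.HasBounds K c M Ω ψ u →
        ∀ x ∈ closure Ω, MinkowskiGraph.wTilde Ω u x ≤
          C * (1 + sSup (MinkowskiGraph.wTilde Ω u '' frontier Ω))) ∧
    (∀ K c M θ : ℝ, 0 < c → 0 < θ → ∃ θ₀ : ℝ, 0 < θ₀ ∧ θ₀ < 1 ∧
      ∀ (Ω : Set (EuclideanSpace ℝ (Fin n))) (ψ : EuclideanSpace ℝ (Fin n) × ℝ → ℝ)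
        (u : EuclideanSpace ℝ (Fin n) → ℝ),
        IsOpen Ω → Bornology.IsBounded Ω → MinkowskiGraph.IsMonotoneSource Ω ψ →
        ContDiffOn ℝ 3 u Ω → MinkowskiGraph.IsAdmissibleSolution k l Ω ψ u →
        MinkowskiGraph.HasBounds K c M Ω ψ u →
        (∀ x ∈ frontier Ω, ‖MinkowskiGraph.gradBar Ω u x‖ ≤ 1 - θ) →
        ∀ x ∈ closure Ω, ‖MinkowskiGraph.gradBar Ω u x‖ ≤ 1 - θ₀) ∧
    (∀ (Ω : Set (EuclideanSpace ℝ (Fin n))) (ψ : EuclideanSpace ℝ (Fin n) × ℝ → ℝ)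
      (v : EuclideanSpace ℝ (Fin n) → ℝ),
      IsOpen Ω → Bornology.IsBounded Ω → MinkowskiGraph.HasSmoothBoundary Ω →
      MinkowskiGraph.IsMonotoneSource Ω ψ → MinkowskiGraph.IsAdmissibleSubsolution k l Ω ψ v →
      ∃ θ₀ : ℝ, 0 < θ₀ ∧ θ₀ < 1 ∧
        ∀ u : EuclideanSpace ℝ (Fin n) → ℝ,
          ContDiffOn ℝ 3 u Ω → MinkowskiGraph.IsAdmissibleSolution k l Ω ψ u →
          ∀ x ∈ closure Ω, ‖MinkowskiGraph.gradBar Ω u x‖ ≤ 1 - θ₀) :=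
  ⟨fun K c M hc => MinkowskiGraph.gradient_estimate hlk K c M hc,
    fun K c M θ hc hθ => MinkowskiGraph.spacelike_estimate hlk K c M θ hc hθ,
    fun _ _ _ hΩ hb hs hψ hv =>
      MinkowskiGraph.spacelike_estimate_of_subsolution hlk hΩ hb hs hψ hv⟩

theorem theorem3p1 {n k l : ℕ} (hk : 2 ≤ k) (hlk : l < k) (hkn : k < n) :
    -- the gradient estimate, with a constant depending only on `n, k, l, K, c, M`
    (∀ K c M : ℝ, 0 < c → ∃ C : ℝ, 0 < C ∧
      ∀ (Ω : Set (EuclideanSpace ℝ (Fin n))) (ψ : EuclideanSpace ℝ (Fin n) × ℝ → ℝ)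
        (u : EuclideanSpace ℝ (Fin n) → ℝ),
        IsOpen Ω → Bornology.IsBounded Ω → MinkowskiGraph.IsMonotoneSource Ω ψ →
        ContDiffOn ℝ 3 u Ω → MinkowskiGraph.IsAdmissibleSolution k l Ω ψ u →
        MinkowskiGraph.HasBounds K c M Ω ψ u →
        ∀ x ∈ closure Ω, MinkowskiGraph.wTilde Ω u x ≤
          C * (1 + sSup (MinkowskiGraph.wTilde Ω u '' frontier Ω))) ∧
    -- the spacelike bound in terms of the boundary gradient bound
    (∀ K c M θ : ℝ, 0 < c → 0 < θ → θ < 1 → ∃ θ₀ : ℝ, 0 < θ₀ ∧ θ₀ < 1 ∧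
      ∀ (Ω : Set (EuclideanSpace ℝ (Fin n))) (ψ : EuclideanSpace ℝ (Fin n) × ℝ → ℝ)
        (u : EuclideanSpace ℝ (Fin n) → ℝ),
        IsOpen Ω → Bornology.IsBounded Ω → MinkowskiGraph.IsMonotoneSource Ω ψ →
        ContDiffOn ℝ 3 u Ω → MinkowskiGraph.IsAdmissibleSolution k l Ω ψ u →
        MinkowskiGraph.HasBounds K c M Ω ψ u →
        (∀ x ∈ frontier Ω, ‖MinkowskiGraph.gradBar Ω u x‖ ≤ 1 - θ) →
        ∀ x ∈ closure Ω, ‖MinkowskiGraph.gradBar Ω u x‖ ≤ 1 - θ₀) ∧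
    -- the uniform spacelike bound for the Dirichlet problem with an admissible subsolution
    (∀ (Ω : Set (EuclideanSpace ℝ (Fin n))) (ψ : EuclideanSpace ℝ (Fin n) × ℝ → ℝ)
      (v : EuclideanSpace ℝ (Fin n) → ℝ),
      IsOpen Ω → Bornology.IsBounded Ω → MinkowskiGraph.HasSmoothBoundary Ω →
      MinkowskiGraph.IsMonotoneSource Ω ψ → MinkowskiGraph.IsAdmissibleSubsolution k l Ω ψ v →
      ∃ θ₀ : ℝ, 0 < θ₀ ∧ θ₀ < 1 ∧
        ∀ u : EuclideanSpace ℝ (Fin n) → ℝ,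
          ContDiffOn ℝ 3 u Ω → MinkowskiGraph.IsAdmissibleSolution k l Ω ψ u →
          ∀ x ∈ closure Ω, ‖MinkowskiGraph.gradBar Ω u x‖ ≤ 1 - θ₀) := by
  obtain ⟨h_gradient, h_spacelike, h_subsolution⟩ := theorem3p1_general (n := n) hlk
  exact ⟨h_gradient, fun K c M θ hc hθ _ => h_spacelike K c M θ hc hθ, h_subsolution⟩
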